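/- Let $(V,\langle-,-\rangle)$ be a complex vector space of dimension $10$ with a non-degenerate symmetric bilinear form, and let $(W,(-,-)_W)$ be a complex vector space of dimension $2$ with a non-degenerate symmetric bilinear form. Fix a decomposition $V=L\oplus L'$ into isotropic subspaces (so both are maximally isotropic and $L'\cong L^\vee$ via $\langle-,-\rangle$), let $S=\wedge^\bullet L^\vee$ be the spinor module, on which $L$ acts by contraction and $L'\cong L^\vee$ by exterior multiplication, and let $S_+=\wedge^{\mathrm{even}}L^\vee$. A spinor $\psi\in S_+$ is called pure if its annihilator $\{v\in V : v\cdot\psi=0\}$ under Clifford multiplication is a maximally isotropic subspace of $V$; let $\mathcal P\subset\mathbb P(S_+)$ be the variety of lines spanned by pure spinors. Let $G=\mathrm{Spin}(V)\times \mathrm O(W)\times\mathbb C^\times$ act on $S_+\otimes W$ by $(g,A,t)\cdot(\psi\otimes w)=t\,(g\psi\otimes Aw)$, and on pairs $(U,\varphi)$, where $U\subset S_+$ is a linear subspace and $\varphi:W^\vee\to U$ is a linear isomorphism, by $(g,A,t)\cdot(U,\varphi)=(gU,\ f\mapsto t\,g\,\varphi(f\circ A))$. Then $G$ acts transitively on the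 (non-empty, $G$-invariant) set of pairs $(U,\varphi)$ such that $U$ is two-dimensional and $\mathcal P\cap\mathbb P(U)=\mathbb P(U)$. Likewise, the supercharges $Q\in S_+\otimes W$ which, viewed as linear maps $W^\vee\to S_+$, have rank two and image $S_Q$ satisfying $\mathcal P\cap\mathbb P(S_Q)=\mathbb P(S_Q)$ form a single (non-empty) $G$-orbit. -/

import Mathlib

open scoped TensorProduct LinearAlgebra.Projectivization

noncomputable section

namespace IIB

/-! A non-degenerate symmetric inner product `⟨-,-⟩` on a complex vector space is given by its
quadratic form `Q v = ⟨v, v⟩ / 2`, so that `⟨v, w⟩ = QuadraticMap.polar Q v w`, and the Clifford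
relation `v * v = Q v` reads `v * w + w * v = ⟨v, w⟩`. -/

section Spinors

variable {V : Type*} [AddCommGroup V] [Module ℂ V]

/-- A subspace on which the inner product vanishes identically. -/
def IsIsotropic (Q : QuadraticForm ℂ V) (N : Submodule ℂ V) : Prop :=
  ∀ x ∈ N, ∀ y ∈ N, QuadraticMap.polar Q x y = 0

theorem IsIsotropic.apply_eq_zero {Q : QuadraticForm ℂ V} {N : Submodule ℂ V}
    (h : IsIsotropic Q N) {x : V} (hx : x ∈ N) : Q x = 0 := by
  have h2 := h x hx x hx
  rw [QuadraticMap.polar_self] at h2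
  simpa using h2

/-- A decomposition `V = L ⊕ L'` into two isotropic subspaces. When the inner product is
non-degenerate, it pairs `L'` perfectly with `L`, so that this is `V ≅ L ⊕ L^∨`, and both
subspaces are maximally isotropic. -/
structure Polarization (Q : QuadraticForm ℂ V) where
  /-- the maximally isotropic subspace used to build the spinors -/
  L : Submodule ℂ V
  /-- the complementary isotropic subspace, in the role of the dual of `L` -/
  L' : Submodule ℂ V
  isCompl : IsCompl L L'
  isotropic : IsIsotropic Q L
  isotropic' : IsIsotropic Q L'

variable {Q : QuadraticForm ℂ V}

namespace Polarization

variable (P : Polarization Q)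

/-- The component in `L` of a vector. -/
def projL : V →ₗ[ℂ] P.L := P.L.projectionOnto P.L' P.isCompl

/-- The component in `L'` of a vector. -/
def projL' : V →ₗ[ℂ] P.L' := P.L'.projectionOnto P.L P.isCompl.symm

/-- The dual vector `⟨v', -⟩` on `L`, where `v'` is the component of `v` in `L'`. -/
def covector : V →ₗ[ℂ] Module.Dual ℂ P.L :=
  (Q.polarBilin.compl₂ P.L.subtype) ∘ₗ P.L'.subtype ∘ₗ P.projL'

/-- The Dirac spinors, the exterior algebra of the dual of `L`. -/
abbrev Spinor : Type _ := ExteriorAlgebra ℂ (Module.Dual ℂ P.L)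

/-- Contraction of a form by a vector of `L`. -/
def contraction : P.L →ₗ[ℂ] Module.End ℂ P.Spinor :=
  CliffordAlgebra.contractLeft ∘ₗ Module.Dual.eval ℂ P.L

/-- Clifford multiplication by a vector: its component in `L` acts by contraction, its component
in `L'` by the exterior product with the corresponding dual vector of `L`. -/
def cliffordMul : V →ₗ[ℂ] Module.End ℂ P.Spinor :=
  P.contraction ∘ₗ P.projL +
    (LinearMap.mul ℂ P.Spinor) ∘ₗ (ExteriorAlgebra.ι ℂ) ∘ₗ P.covector

theorem cliffordMul_apply (v : V) (ψ : P.Spinor) :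
    P.cliffordMul v ψ = P.contraction (P.projL v) ψ + ExteriorAlgebra.ι ℂ (P.covector v) * ψ :=
  rfl

theorem covector_projL (v : V) : P.covector v (P.projL v) = Q v := by
  have hv : (P.projL v : V) + (P.projL' v : V) = v := by
    have h := Submodule.projection_add_projection_eq_self P.isCompl v
    rwa [← Submodule.coe_projectionOnto_apply, ← Submodule.coe_projectionOnto_apply] at h
  have h1 : Q (P.projL v : V) = 0 := P.isotropic.apply_eq_zero (P.projL v).2
  have h2 : Q (P.projL' v : V) = 0 := P.isotropic'.apply_eq_zero (P.projL' v).2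
  have h3 : Q ((P.projL' v : V) + (P.projL v : V)) = Q v := by rw [add_comm, hv]
  simp [covector, QuadraticMap.polar, h1, h2, h3]

theorem cliffordMul_sq (v : V) :
    P.cliffordMul v * P.cliffordMul v = algebraMap ℂ (Module.End ℂ P.Spinor) (Q v) := by
  refine LinearMap.ext fun ψ => ?_
  have h1 : ExteriorAlgebra.ι ℂ (P.covector v) * (ExteriorAlgebra.ι ℂ (P.covector v) * ψ) = 0 := by
    rw [← mul_assoc, ExteriorAlgebra.ι_sq_zero, zero_mul]
  have h2 : P.contraction (P.projL v) (P.contraction (P.projL v) ψ) = 0 :=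
    CliffordAlgebra.contractLeft_contractLeft _ _
  have h3 : P.contraction (P.projL v) (ExteriorAlgebra.ι ℂ (P.covector v) * ψ)
      = P.covector v (P.projL v) • ψ
        - ExteriorAlgebra.ι ℂ (P.covector v) * P.contraction (P.projL v) ψ :=
    CliffordAlgebra.contractLeft_ι_mul _ _ _
  rw [Module.End.mul_apply, cliffordMul_apply P v ψ, cliffordMul_apply, map_add, mul_add, h1, h2,
    h3, covector_projL, Module.algebraMap_end_apply]
  abel

/-- The action of the Clifford algebra of `V` on the spinors. -/
def cliffordAction : CliffordAlgebra Q →ₐ[ℂ] Module.End ℂ P.Spinor :=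
  CliffordAlgebra.lift Q ⟨P.cliffordMul, P.cliffordMul_sq⟩

theorem cliffordAction_ι (v : V) : P.cliffordAction (CliffordAlgebra.ι Q v) = P.cliffordMul v :=
  CliffordAlgebra.lift_ι_apply _ _ _

/-- The spinors of positive chirality, the sum of the exterior powers of even degree. -/
def evenPart : Submodule ℂ P.Spinor := ⨆ k : ℕ, ⋀[ℂ]^(2 * k) (Module.Dual ℂ P.L)

theorem evenPart_eq : P.evenPart = CliffordAlgebra.evenOdd 0 0 := by
  apply le_antisymm
  · refine iSup_le fun k => ?_
    exact le_iSup (fun j : {n : ℕ // (n : ZMod 2) = 0} =>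
      LinearMap.range (CliffordAlgebra.ι (0 : QuadraticForm ℂ (Module.Dual ℂ P.L))) ^ (j : ℕ))
      ⟨2 * k, (ZMod.natCast_eq_zero_iff _ _).2 (dvd_mul_right 2 k)⟩
  · refine iSup_le fun j => ?_
    obtain ⟨n, hn⟩ := j
    obtain ⟨k, rfl⟩ := (ZMod.natCast_eq_zero_iff _ _).1 hn
    exact le_iSup (fun k : ℕ => ⋀[ℂ]^(2 * k) (Module.Dual ℂ P.L)) k

theorem contractLeft_mem {M : Type*} [AddCommGroup M] [Module ℂ M] {q : QuadraticForm ℂ M}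
    (d : Module.Dual ℂ M) {i : ZMod 2} {x : CliffordAlgebra q}
    (hx : x ∈ CliffordAlgebra.evenOdd q i) :
    CliffordAlgebra.contractLeft d x ∈ CliffordAlgebra.evenOdd q (i + 1) := by
  have hι := CliffordAlgebra.ι_mem_evenOdd_one q
  have hmul : ∀ (m : M) {j : ZMod 2} {y : CliffordAlgebra q},
      y ∈ CliffordAlgebra.evenOdd q j → CliffordAlgebra.ι q m * y
        ∈ CliffordAlgebra.evenOdd q (j + 1) := by
    intro m j y hy
    rw [add_comm]
    exact CliffordAlgebra.evenOdd_mul_le q _ _ (Submodule.mul_mem_mul (hι m) hy)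
  induction x, hx using CliffordAlgebra.evenOdd_induction with
  | range_ι_pow v h =>
    fin_cases i
    · have h' : v ∈ LinearMap.range (CliffordAlgebra.ι q) ^ 0 := h
      rw [pow_zero, Submodule.mem_one] at h'
      obtain ⟨r, rfl⟩ := h'
      simp [CliffordAlgebra.contractLeft_algebraMap]
    · have h' : v ∈ LinearMap.range (CliffordAlgebra.ι q) ^ 1 := h
      rw [pow_one] at h'
      obtain ⟨m, rfl⟩ := h'
      rw [CliffordAlgebra.contractLeft_ι, Algebra.algebraMap_eq_smul_one]
      exact Submodule.smul_mem _ _ (CliffordAlgebra.one_le_evenOdd_zero q (Submodule.mem_one.2 ⟨1, map_one _⟩))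
  | add x y hx hy ihx ihy => rw [map_add]; exact Submodule.add_mem _ ihx ihy
  | ι_mul_ι_mul m₁ m₂ x hx ih =>
    rw [mul_assoc, CliffordAlgebra.contractLeft_ι_mul, CliffordAlgebra.contractLeft_ι_mul]
    have e : ∀ j : ZMod 2, j + 1 + 1 = j := by decide
    refine Submodule.sub_mem _ (Submodule.smul_mem _ _ (hmul _ hx)) ?_
    refine hmul _ (Submodule.sub_mem _ (Submodule.smul_mem _ _ hx) ?_)
    simpa only [e] using hmul m₂ ih

theorem cliffordMul_mem (v : V) {i : ZMod 2} {ψ : P.Spinor}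
    (hψ : ψ ∈ CliffordAlgebra.evenOdd 0 i) :
    P.cliffordMul v ψ ∈ CliffordAlgebra.evenOdd 0 (i + 1) := by
  rw [cliffordMul_apply]
  refine Submodule.add_mem _ (contractLeft_mem _ hψ) ?_
  rw [add_comm]
  exact CliffordAlgebra.evenOdd_mul_le _ _ _
    (Submodule.mul_mem_mul (CliffordAlgebra.ι_mem_evenOdd_one _ _) hψ)

theorem cliffordAction_mem {x : CliffordAlgebra Q} (hx : x ∈ CliffordAlgebra.even Q)
    {ψ : P.Spinor} (hψ : ψ ∈ P.evenPart) : P.cliffordAction x ψ ∈ P.evenPart := by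
  rw [evenPart_eq] at hψ ⊢
  have hx' : x ∈ CliffordAlgebra.evenOdd Q 0 := hx
  have e : (0 : ZMod 2) + 1 + 1 = 0 := by decide
  clear hx
  induction x, hx' using CliffordAlgebra.even_induction with
  | algebraMap r =>
    rw [AlgHom.commutes, Module.algebraMap_end_apply]
    exact Submodule.smul_mem _ _ hψ
  | add x y hx hy ihx ihy =>
    rw [map_add]
    exact Submodule.add_mem _ ihx ihy
  | ι_mul_ι_mul m₁ m₂ x hx ih =>
    rw [map_mul, map_mul, cliffordAction_ι, cliffordAction_ι]
    have := P.cliffordMul_mem m₁ (P.cliffordMul_mem m₂ ih)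
    rwa [e] at this

/-- The half-spin space `S_+`. -/
abbrev SPlus : Type _ := P.evenPart

/-- The spin representation of `Spin(V)` on `S_+`. -/
def spinRep : Representation ℂ (spinGroup Q) P.SPlus where
  toFun g := (P.cliffordAction (g : CliffordAlgebra Q)).restrict
    fun _ hψ => P.cliffordAction_mem (spinGroup.mem_even g.2) hψ
  map_one' := by
    ext ψ
    simp
  map_mul' g h := by
    ext ψ
    simp

/-- The annihilator of a spinor under Clifford multiplication. -/
def annihilator (ψ : P.SPlus) : Submodule ℂ V :=
  LinearMap.ker (P.cliffordMul.flip (ψ : P.Spinor))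

/-- A spinor is pure if its annihilator is maximally isotropic. -/
def IsPure (ψ : P.SPlus) : Prop := Maximal (IsIsotropic Q) (P.annihilator ψ)

/-- The variety of pure spinors in `ℙ(S_+)`. -/
def pureVariety : Set (ℙ ℂ P.SPlus) :=
  {p | ∃ (ψ : P.SPlus) (h : ψ ≠ 0), P.IsPure ψ ∧ p = Projectivization.mk ℂ ψ h}

/-- The projectivization of a subspace of `S_+`, as a subset of `ℙ(S_+)`. -/
def projSpan (U : Submodule ℂ P.SPlus) : Set (ℙ ℂ P.SPlus) := {p | p.submodule ≤ U}

end Polarization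

end Spinors

section Action

variable {V : Type*} [AddCommGroup V] [Module ℂ V] {Q : QuadraticForm ℂ V}
variable {W : Type*} [AddCommGroup W] [Module ℂ W] {q : QuadraticForm ℂ W}

/-- The orthogonal group `O(W)`. -/
def orthogonalGroup (q : QuadraticForm ℂ W) : Subgroup (W ≃ₗ[ℂ] W) where
  carrier := {A | ∀ w, q (A w) = q w}
  mul_mem' {A B} hA hB w := by
    rw [LinearEquiv.mul_apply, hA, hB]
  one_mem' _ := rfl
  inv_mem' {A} hA w := by
    have h := hA (A⁻¹ w)
    rw [← h, ← LinearEquiv.mul_apply, mul_inv_cancel, LinearEquiv.coe_one, id]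

/-- The group `G = Spin(V) × O(W) × ℂˣ`. -/
abbrev Symm (Q : QuadraticForm ℂ V) (q : QuadraticForm ℂ W) : Type _ :=
  spinGroup Q × orthogonalGroup q × ℂˣ

variable (P : Polarization Q)

/-- The action of `G` on `S_+`: the spin representation, with `ℂˣ` acting by rescaling. -/
def spinorRep (q : QuadraticForm ℂ W) : Representation ℂ (Symm Q q) P.SPlus where
  toFun g := (g.2.2 : ℂ) • P.spinRep g.1
  map_one' := by simp
  map_mul' g h := by
    ext ψ
    simp [mul_smul, smul_comm (g.2.2 : ℂ)]

/-- The action of `G` on `S_+` through invertible linear maps. -/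
def spinorEquiv (q : QuadraticForm ℂ W) : Symm Q q →* (P.SPlus ≃ₗ[ℂ] P.SPlus) :=
  (LinearMap.GeneralLinearGroup.generalLinearEquiv ℂ P.SPlus).toMonoidHom.comp
    (MonoidHom.toHomUnits (spinorRep P q))

theorem spinorEquiv_apply (g : Symm Q q) (ψ : P.SPlus) :
    spinorEquiv P q g ψ = (g.2.2 : ℂ) • P.spinRep g.1 ψ := rfl

/-- A pair `(U, φ)` of a subspace `U` of `S_+` and an isomorphism from the dual of `W` to `U`. -/
structure FramedSubspace (P : Polarization Q) (W : Type*) [AddCommGroup W] [Module ℂ W] where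
  /-- the subspace -/
  U : Submodule ℂ P.SPlus
  /-- the isomorphism -/
  φ : Module.Dual ℂ W ≃ₗ[ℂ] U

theorem FramedSubspace.ext' {x y : FramedSubspace P W} (hU : x.U = y.U)
    (hφ : ∀ f, (x.φ f : P.SPlus) = y.φ f) : x = y := by
  obtain ⟨U, φ⟩ := x
  obtain ⟨U', φ'⟩ := y
  obtain rfl : U = U' := hU
  congr 1
  ext f : 2
  exact hφ f

/-- The action of `G` on pairs: `(g, A, t) • (U, φ) = (g U, f ↦ t • g (φ (f ∘ A)))`. -/
instance : MulAction (Symm Q q) (FramedSubspace P W) where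
  smul g x :=
    { U := x.U.map (spinorEquiv P q g : P.SPlus →ₗ[ℂ] P.SPlus)
      φ := ((g.2.1 : W ≃ₗ[ℂ] W).dualMap.trans x.φ).trans
        ((spinorEquiv P q g).submoduleMap x.U) }
  one_smul x := by
    refine FramedSubspace.ext' P ?_ fun f => ?_
    · change x.U.map (spinorEquiv P q 1 : P.SPlus →ₗ[ℂ] P.SPlus) = x.U
      rw [map_one]
      exact Submodule.map_id _
    · change spinorEquiv P q 1 (x.φ f) = x.φ f
      rw [map_one]
      rfl
  mul_smul g h x := by
    refine FramedSubspace.ext' P ?_ fun f => ?_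
    · change x.U.map (spinorEquiv P q (g * h) : P.SPlus →ₗ[ℂ] P.SPlus) =
        (x.U.map (spinorEquiv P q h : P.SPlus →ₗ[ℂ] P.SPlus)).map
          (spinorEquiv P q g : P.SPlus →ₗ[ℂ] P.SPlus)
      rw [map_mul, ← Submodule.map_comp]
      rfl
    · change spinorEquiv P q (g * h) (x.φ _) = spinorEquiv P q g (spinorEquiv P q h (x.φ _))
      rw [map_mul]
      rfl

/-- The pairs `(U, φ)` with `U` two-dimensional and `ℙ(U)` contained in the pure spinor variety
`𝒫`, that is `𝒫 ∩ ℙ(U) = ℙ(U)`. -/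
def purePairs (P : Polarization Q) (W : Type*) [AddCommGroup W] [Module ℂ W] :
    Set (FramedSubspace P W) :=
  {x | Module.finrank ℂ x.U = 2 ∧ P.pureVariety ∩ P.projSpan x.U = P.projSpan x.U}

/-- The supercharges, the elements of `S_+ ⊗ W`. -/
abbrev Supercharge (P : Polarization Q) (W : Type*) [AddCommGroup W] [Module ℂ W] : Type _ :=
  P.SPlus ⊗[ℂ] W

/-- The action of `G` on supercharges: `(g, A, t) • (ψ ⊗ w) = t • (g ψ ⊗ A w)`. -/
instance : MulAction (Symm Q q) (Supercharge P W) where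
  smul g x := TensorProduct.map (spinorRep P q g) ((g.2.1 : W ≃ₗ[ℂ] W) : W →ₗ[ℂ] W) x
  one_smul x := by
    change TensorProduct.map (spinorRep P q 1) (LinearMap.id : W →ₗ[ℂ] W) x = x
    rw [map_one, Module.End.one_eq_id, TensorProduct.map_id, LinearMap.id_apply]
  mul_smul g h x := by
    change TensorProduct.map (spinorRep P q (g * h))
        (((g.2.1 : W ≃ₗ[ℂ] W) : W →ₗ[ℂ] W) ∘ₗ ((h.2.1 : W ≃ₗ[ℂ] W) : W →ₗ[ℂ] W)) x = _
    rw [map_mul, Module.End.mul_eq_comp, TensorProduct.map_comp]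
    rfl

/-- A supercharge, viewed as a linear map from the dual of `W` to `S_+`. -/
def Supercharge.toMap (x : Supercharge P W) : Module.Dual ℂ W →ₗ[ℂ] P.SPlus where
  toFun f := TensorProduct.rid ℂ P.SPlus (f.lTensor P.SPlus x)
  map_add' f f' := by
    rw [LinearMap.lTensor_add, LinearMap.add_apply, map_add]
  map_smul' c f := by
    rw [LinearMap.lTensor_smul, LinearMap.smul_apply, map_smul, RingHom.id_apply]

/-- The supercharges of rank two with image `S` such that `ℙ(S)` is contained in the pure spinor
variety. -/
def pureSupercharges (P : Polarization Q) (W : Type*) [AddCommGroup W] [Module ℂ W] :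
    Set (Supercharge P W) :=
  {x | Module.finrank ℂ (LinearMap.range (x.toMap P)) = 2 ∧
    P.pureVariety ∩ P.projSpan (LinearMap.range (x.toMap P)) =
      P.projSpan (LinearMap.range (x.toMap P))}

end Action

end IIB

end

/-!
The orthogonal group of `W` is not needed: `Spin(V) × ℂˣ` acts transitively on the injective linear
maps from the two-dimensional space `W^∨` to `S_+` whose nonzero values are pure
(`IsPureMap.exists_spinorRep_eq`), and both the pairs `(U, φ)` and the supercharges are such maps.
So it suffices to move a basis `ψ₁`, `ψ₂` of a plane of pure spinors to `1`, `α ∧ β`, for fixed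
independent dual vectors `α`, `β` of `L` (`exists_spinOperators_pair`).

The group elements come from one family: if `x`, `y` are isotropic vectors with `⟨x, y⟩ ≠ -1`, then
`1 + x * y` is a multiple of an element of the spin group (`one_add_ι_mul_ι_mem_scaledSpin`). On
spinors these are the operators `1 + α ∧ β ∧ -`, `1 + l ⌟ (m ⌟ -)` and, when `α l ≠ -1`,
`1 + α ∧ (l ⌟ -)`.

*One pure spinor.* The spin group spans the even Clifford algebra, and some product of contractions
sends a nonzero even spinor to a nonzero scalar, so that some group element gives it a nonzero
scalar part. Operators `1 + α ∧ β ∧ -` remove the component of degree two. The annihilator of the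
resulting spinor lies in `L`. If the spinor is pure, the annihilator is therefore `L`, and a form
killed by all contractions is a scalar. This moves `ψ₁` to `1`, and shows moreover that the
contractions of a pure spinor `ψ` with nonzero scalar part are exterior products `λ ∧ ψ` of `ψ` with
dual vectors (`IsPureSpinor.exists_eq_one`).

*The second one.* Let `η` be the image of `ψ₂` minus its scalar part. Applied to the pure spinors
`1 + s • η` for `s = 1, 2`, the last property says that every contraction `l ⌟ η` is a dual vector
whose exterior product with `η` vanishes. Contracting this product once more writes `η` as a product
of two dual vectors. An operator `1 + l ⌟ (m ⌟ -)` removes the scalar part, and two operators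
`1 + α ∧ (l ⌟ -)`, which fix `1` and act on the dual vectors by `γ ↦ γ + γ l • α`, move the factors
one after the other to those of the fixed product.
-/

namespace IIB

namespace Polarization

/-! ### Contractions of exterior forms -/

section Contraction

variable {V : Type*} [AddCommGroup V] [Module ℂ V] {Q : QuadraticForm ℂ V} (P : Polarization Q)

/-- The component of degree zero of a spinor. -/
def scalarPart : P.Spinor →ₐ[ℂ] ℂ := ExteriorAlgebra.algebraMapInv

/-- The exterior product with a dual vector of `L`. -/
def wedge (α : Module.Dual ℂ P.L) : Module.End ℂ P.Spinor :=
  LinearMap.mulLeft ℂ (ExteriorAlgebra.ι ℂ α)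

variable {P}

theorem wedge_apply (α : Module.Dual ℂ P.L) (ψ : P.Spinor) :
    P.wedge α ψ = ExteriorAlgebra.ι ℂ α * ψ := rfl

theorem wedge_add (α β : Module.Dual ℂ P.L) (ψ : P.Spinor) :
    P.wedge (α + β) ψ = P.wedge α ψ + P.wedge β ψ := by
  simp [wedge_apply, add_mul]

theorem wedge_sub (α β : Module.Dual ℂ P.L) (ψ : P.Spinor) :
    P.wedge (α - β) ψ = P.wedge α ψ - P.wedge β ψ := by
  simp [wedge_apply, sub_mul]

theorem neg_wedge (α : Module.Dual ℂ P.L) (ψ : P.Spinor) : P.wedge (-α) ψ = -P.wedge α ψ := by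
  simp [wedge_apply]

theorem wedge_smul (c : ℂ) (α : Module.Dual ℂ P.L) (ψ : P.Spinor) :
    P.wedge (c • α) ψ = c • P.wedge α ψ := by
  simp [wedge_apply]

theorem wedge_wedge_self (α : Module.Dual ℂ P.L) (ψ : P.Spinor) :
    P.wedge α (P.wedge α ψ) = 0 := by
  rw [wedge_apply, wedge_apply, ← mul_assoc, ExteriorAlgebra.ι_sq_zero, zero_mul]

theorem wedge_comm (α β : Module.Dual ℂ P.L) (ψ : P.Spinor) :
    P.wedge α (P.wedge β ψ) = -P.wedge β (P.wedge α ψ) := by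
  rw [eq_neg_iff_add_eq_zero]
  simp only [wedge_apply, ← mul_assoc, ← add_mul, ExteriorAlgebra.ι_add_mul_swap, zero_mul]

theorem contraction_wedge (l : P.L) (α : Module.Dual ℂ P.L) (ψ : P.Spinor) :
    P.contraction l (P.wedge α ψ) = α l • ψ - P.wedge α (P.contraction l ψ) :=
  CliffordAlgebra.contractLeft_ι_mul _ _ _

theorem contraction_algebraMap (l : P.L) (r : ℂ) :
    P.contraction l (algebraMap ℂ P.Spinor r) = 0 :=
  CliffordAlgebra.contractLeft_algebraMap _ _ _

theorem contraction_one (l : P.L) : P.contraction l 1 = 0 :=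
  CliffordAlgebra.contractLeft_one _ _

theorem contraction_self (l : P.L) (ψ : P.Spinor) :
    P.contraction l (P.contraction l ψ) = 0 :=
  CliffordAlgebra.contractLeft_contractLeft _ _

theorem contraction_comm (l m : P.L) (ψ : P.Spinor) :
    P.contraction l (P.contraction m ψ) = -P.contraction m (P.contraction l ψ) :=
  CliffordAlgebra.contractLeft_comm _ _ _

@[simp] theorem scalarPart_wedge (α : Module.Dual ℂ P.L) (ψ : P.Spinor) :
    P.scalarPart (P.wedge α ψ) = 0 := by
  simp [wedge_apply, scalarPart, ExteriorAlgebra.algebraMapInv]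

@[simp] theorem scalarPart_algebraMap (r : ℂ) : P.scalarPart (algebraMap ℂ P.Spinor r) = r :=
  ExteriorAlgebra.algebraMap_leftInverse _ r

/-- Every form is built from the scalars by exterior products with dual vectors. -/
theorem spinor_induction {C : P.Spinor → Prop} (algebraMap : ∀ r, C (algebraMap ℂ P.Spinor r))
    (add : ∀ x y, C x → C y → C (x + y)) (wedge : ∀ α x, C x → C (P.wedge α x))
    (ψ : P.Spinor) : C ψ :=
  CliffordAlgebra.left_induction _ algebraMap add (fun x α hx => wedge α x hx) ψ

/-- When `ε f = 1`, the endomorphism of the exterior algebra that kills `ε` and fixes the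
annihilator of `f` is the exterior product with `ε` followed by contraction with `f`. -/
theorem map_sub_smulRight_apply (f : P.L) (ε : Module.Dual ℂ P.L) (h : ε f = 1) (ψ : P.Spinor) :
    ExteriorAlgebra.map (LinearMap.id - (Module.Dual.eval ℂ P.L f).smulRight ε) ψ
      = P.contraction f (P.wedge ε ψ) := by
  induction ψ using spinor_induction with
  | algebraMap r =>
    rw [AlgHom.commutes, contraction_wedge, contraction_algebraMap, h, map_zero, sub_zero, one_smul]
  | add x y hx hy => rw [map_add, map_add, map_add, hx, hy]
  | wedge α x hx =>
    have h1 : ExteriorAlgebra.map (LinearMap.id - (Module.Dual.eval ℂ P.L f).smulRight ε)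
        (P.wedge α x) = P.wedge (α - α f • ε) (P.contraction f (P.wedge ε x)) := by
      rw [← hx, wedge_apply, map_mul, ExteriorAlgebra.map_apply_ι]
      rfl
    rw [h1, wedge_sub, wedge_smul]
    simp only [contraction_wedge, map_sub, wedge_wedge_self, h, wedge_comm ε α, one_smul,
      map_neg, sub_zero]
    abel

/-- A form killed by every contraction is a scalar: its image under the substitution that kills
a basis of dual vectors one after the other is the form itself. -/
theorem eq_algebraMap_of_contraction_eq_zero [FiniteDimensional ℂ P.L] {ψ : P.Spinor}
    (h : ∀ l, P.contraction l ψ = 0) : ψ = algebraMap ℂ P.Spinor (P.scalarPart ψ) := by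
  classical
  let b := Module.finBasis ℂ P.L
  have key : ∀ s : Finset (Fin (Module.finrank ℂ P.L)), ∃ T : Module.End ℂ (Module.Dual ℂ P.L),
      ExteriorAlgebra.map T ψ = ψ ∧ ∀ i ∈ s, T (b.coord i) = 0 := by
    intro s
    induction s using Finset.induction_on with
    | empty => exact ⟨LinearMap.id, by simp, by simp⟩
    | insert i s _ ih =>
      obtain ⟨T, hT, hs⟩ := ih
      have hi : b.coord i (b i) = 1 := by simp
      set π := (LinearMap.id - (Module.Dual.eval ℂ P.L (b i)).smulRight (b.coord i) :
        Module.End ℂ (Module.Dual ℂ P.L)) with hπ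
      -- Composing with `π` on the right keeps the coordinates already killed by `T`,
      -- since `π` fixes them.
      refine ⟨T ∘ₗ π, ?_, fun j hj => ?_⟩
      · rw [← ExteriorAlgebra.map_comp_map, AlgHom.comp_apply, hπ, map_sub_smulRight_apply _ _ hi,
          contraction_wedge, h, hi, map_zero, sub_zero, one_smul, hT]
      · rw [LinearMap.comp_apply]
        by_cases hij : j = i
        · subst hij
          simp [hπ]
        · have : π (b.coord j) = b.coord j := by
            simp [hπ, Ne.symm hij]
          rw [this]
          exact hs j ((Finset.mem_insert.1 hj).resolve_left hij)
  obtain ⟨T, hT, h0⟩ := key Finset.univ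
  have hT0 : T = 0 := b.dualBasis.ext fun i => by
    simpa [Module.Basis.coe_dualBasis] using h0 i (Finset.mem_univ i)
  have hmap : (ExteriorAlgebra.map T : P.Spinor →ₐ[ℂ] P.Spinor)
      = (Algebra.ofId ℂ P.Spinor).comp P.scalarPart := by
    apply ExteriorAlgebra.hom_ext
    ext α
    simp [hT0, scalarPart, ExteriorAlgebra.algebraMapInv]
  rw [hmap] at hT
  exact hT.symm

theorem exists_contraction_ne_zero [FiniteDimensional ℂ P.L] {ψ : P.Spinor} (h0 : ψ ≠ 0)
    (h : P.scalarPart ψ = 0) : ∃ l, P.contraction l ψ ≠ 0 := by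
  by_contra! hc
  apply h0
  rw [eq_algebraMap_of_contraction_eq_zero hc, h, map_zero]

/-- The factors of a nonzero product of two dual vectors are independent, which is stated here as a
vector killed by the first factor and not by the second. -/
theorem exists_apply_eq_zero_of_wedge_ne_zero {α β : Module.Dual ℂ P.L}
    (h : P.wedge α (P.wedge β 1) ≠ 0) : ∃ l, α l = 0 ∧ β l ≠ 0 := by
  by_contra! hc
  apply h
  have hβ : β ∈ Submodule.span ℂ (Set.range fun _ : Unit => α) :=
    mem_span_of_iInf_ker_le_ker fun l hl => hc l (by simpa using hl)
  rw [Set.range_const, Submodule.mem_span_singleton] at hβ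
  obtain ⟨c, rfl⟩ := hβ
  rw [wedge_smul, map_smul, wedge_wedge_self, smul_zero]

theorem wedge_wedge_one_ne_zero {α β : Module.Dual ℂ P.L} {l m : P.L} (hαl : α l = 0)
    (hβl : β l ≠ 0) (hαm : α m ≠ 0) : P.wedge α (P.wedge β 1) ≠ 0 := by
  intro h
  have h1 : P.contraction m (P.contraction l (P.wedge α (P.wedge β 1))) = -(α m * β l) • 1 := by
    simp [contraction_wedge, contraction_one, hαl, mul_comm, smul_smul]
  have h2 := congrArg P.scalarPart h1
  rw [h] at h2
  simp [hβl, hαm] at h2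

end Contraction

end Polarization

/-! ### Multiples of elements of the spin group -/

section ScaledSpin

variable {V : Type*} [AddCommGroup V] [Module ℂ V] {Q : QuadraticForm ℂ V}

open CliffordAlgebra

/-- The nonzero multiples of elements of the spin group, the image of `Spin(V) × ℂˣ` in the
Clifford algebra. -/
def scaledSpin (Q : QuadraticForm ℂ V) : Submonoid (CliffordAlgebra Q) where
  carrier := {x | ∃ (t : ℂˣ) (g : spinGroup Q), x = (t : ℂ) • (g : CliffordAlgebra Q)}
  one_mem' := ⟨1, 1, by simp⟩
  mul_mem' := by
    rintro _ _ ⟨t, g, rfl⟩ ⟨u, h, rfl⟩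
    exact ⟨t * u, g * h, by simp [smul_smul, mul_comm]⟩

theorem exists_scaledSpin_mul_eq_one {x : CliffordAlgebra Q} (hx : x ∈ scaledSpin Q) :
    ∃ y ∈ scaledSpin Q, y * x = 1 ∧ x * y = 1 := by
  obtain ⟨t, g, rfl⟩ := hx
  refine ⟨((t⁻¹ : ℂˣ) : ℂ) • ((g⁻¹ : spinGroup Q) : CliffordAlgebra Q), ⟨_, _, rfl⟩, ?_, ?_⟩
  · rw [smul_mul_smul_comm, ← Submonoid.coe_mul, inv_mul_cancel]
    simp
  · rw [smul_mul_smul_comm, ← Submonoid.coe_mul, mul_inv_cancel]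
    simp

theorem exists_unit_smul_ι {v : V} (hv : Q v ≠ 0) {r : ℂ} (hr : r ≠ 0) :
    ∃ u ∈ lipschitzGroup Q, (u : CliffordAlgebra Q) = r • ι Q v := by
  have h : ι Q v * ι Q v = algebraMap ℂ _ (Q v) := ι_sq_scalar Q v
  refine ⟨⟨r • ι Q v, (r * Q v)⁻¹ • ι Q v, ?_, ?_⟩, Subgroup.subset_closure ⟨r • v, ?_⟩, rfl⟩
  · rw [smul_mul_smul_comm, h, Algebra.smul_def, ← map_mul, ← map_one (algebraMap ℂ _)]
    congr 1
    field_simp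
  · rw [smul_mul_smul_comm, h, Algebra.smul_def, ← map_mul, ← map_one (algebraMap ℂ _)]
    congr 1
    field_simp
  · simp

/-- The product of two non-isotropic vectors is a multiple of an element of the spin group,
because complex numbers have square roots. -/
theorem ι_mul_ι_mem_scaledSpin {v w : V} (hv : Q v ≠ 0) (hw : Q w ≠ 0) :
    ι Q v * ι Q w ∈ scaledSpin Q := by
  obtain ⟨r, hr⟩ := IsAlgClosed.exists_pow_nat_eq (Q v * Q w) (n := 2) two_pos
  have hr0 : r ≠ 0 := by
    rintro rfl
    exact mul_ne_zero hv hw (by rw [← hr]; simp)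
  obtain ⟨a, ha, hav⟩ := exists_unit_smul_ι hv (inv_ne_zero hr0)
  obtain ⟨b, hb, hbw⟩ := exists_unit_smul_ι hw one_ne_zero
  have hg : r⁻¹ • (ι Q v * ι Q w) = ((a * b : (CliffordAlgebra Q)ˣ) : CliffordAlgebra Q) := by
    rw [Units.val_mul, hav, hbw, one_smul, smul_mul_assoc]
  have hstar : star (ι Q v * ι Q w) = ι Q w * ι Q v := by
    rw [star_mul, star_ι, star_ι, neg_mul_neg]
  have h1 : (ι Q w * ι Q v) * (ι Q v * ι Q w) = algebraMap ℂ _ (r ^ 2) := by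
    rw [mul_assoc, ← mul_assoc (ι Q v), ι_sq_scalar, Algebra.left_comm, ι_sq_scalar,
      ← map_mul, hr]
  have h2 : (ι Q v * ι Q w) * (ι Q w * ι Q v) = algebraMap ℂ _ (r ^ 2) := by
    rw [mul_assoc, ← mul_assoc (ι Q w), ι_sq_scalar, Algebra.left_comm, ι_sq_scalar,
      ← map_mul, hr, mul_comm]
  have h3 : r⁻¹ * r⁻¹ * r ^ 2 = 1 := by field_simp
  have hspin : r⁻¹ • (ι Q v * ι Q w) ∈ spinGroup Q := by
    refine ⟨⟨⟨a * b, mul_mem ha hb, hg.symm⟩, ?_, ?_⟩, ?_⟩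
    · rw [CliffordAlgebra.star_smul, hstar, smul_mul_smul_comm, h1, Algebra.smul_def,
        ← map_mul, h3, map_one]
    · rw [CliffordAlgebra.star_smul, hstar, smul_mul_smul_comm, h2, Algebra.smul_def,
        ← map_mul, h3, map_one]
    · exact Submodule.smul_mem _ _ (ι_mul_ι_mem_evenOdd_zero Q v w)
  exact ⟨Units.mk0 r hr0, ⟨_, hspin⟩, by simp [smul_smul, hr0]⟩

theorem algebraMap_injective (Q : QuadraticForm ℂ V) :
    Function.Injective (algebraMap ℂ (CliffordAlgebra Q)) := by
  intro r s h
  have := congrArg (equivExterior Q) h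
  simpa [equivExterior, changeFormEquiv] using this

theorem ι_injective (Q : QuadraticForm ℂ V) : Function.Injective (ι Q) := by
  intro v w h
  have := congrArg (equivExterior Q) h
  simp only [equivExterior, changeFormEquiv_apply, changeForm_ι] at this
  exact (ExteriorAlgebra.ι_inj ℂ v w).1 this

/-- Conjugation by an element of the spin group is an isometry of `V`. -/
theorem exists_isometry_of_mem_spinGroup (g : spinGroup Q) :
    ∃ ρ : V ≃ₗ[ℂ] V, (∀ v, Q (ρ v) = Q v) ∧
      ∀ v, ι Q (ρ v) * (g : CliffordAlgebra Q) = g * ι Q v := by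
  have key : ∀ (g : spinGroup Q) (v : V), ∃ w, ι Q w * (g : CliffordAlgebra Q) = g * ι Q v := by
    intro g v
    obtain ⟨w, hw⟩ := spinGroup.conjAct_smul_ι_mem_range_ι (x := spinGroup.toUnits g) g.2 v
    refine ⟨w, ?_⟩
    rw [hw, ConjAct.units_smul_def, ConjAct.ofConjAct_toConjAct]
    exact Units.inv_mul_cancel_right _ (spinGroup.toUnits g)
  have hinj : ∀ (g : spinGroup Q) {x y : CliffordAlgebra Q},
      x * (g : CliffordAlgebra Q) = y * g → x = y := fun g x y h =>
    (Units.mul_left_inj (spinGroup.toUnits g)).1 h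
  choose f hf using fun g : spinGroup Q => fun v : V => key g v
  have hinv : ∀ (g h : spinGroup Q) (v : V), (h * g : spinGroup Q) = 1 → f h (f g v) = v := by
    intro g h v hhg
    apply ι_injective Q
    have h1 : ι Q (f h (f g v)) * ((h * g : spinGroup Q) : CliffordAlgebra Q)
        = ((h * g : spinGroup Q) : CliffordAlgebra Q) * ι Q v := by
      rw [Submonoid.coe_mul, ← mul_assoc, hf, mul_assoc, hf, mul_assoc]
    rw [hhg] at h1
    simpa using h1
  refine ⟨{ toFun := f g
            map_add' := fun v w => ι_injective Q (hinj g ?_)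
            map_smul' := fun c v => ι_injective Q (hinj g ?_)
            invFun := f g⁻¹
            left_inv := fun v => hinv g g⁻¹ v (inv_mul_cancel g)
            right_inv := fun v => hinv g⁻¹ g v (mul_inv_cancel g) }, fun v => ?_, hf g⟩
  · rw [hf, map_add, map_add, mul_add, add_mul, hf, hf]
  · rw [hf, map_smul, map_smul, RingHom.id_apply, mul_smul_comm, smul_mul_assoc, hf]
  · apply algebraMap_injective Q
    change algebraMap ℂ _ (Q (f g v)) = _
    apply hinj g
    rw [← ι_sq_scalar, mul_assoc, hf, ← mul_assoc, hf, mul_assoc, ι_sq_scalar, Algebra.commutes]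

/-- For isotropic vectors `x`, `y` with `⟨x, y⟩ ≠ 0, -1`, the element `1 + x * y` is a product of
two non-isotropic vectors of the plane spanned by `x` and `y`. -/
theorem one_add_ι_mul_ι_mem_scaledSpin_of_polar_ne_zero {x y : V} (hx : Q x = 0) (hy : Q y = 0)
    (h0 : QuadraticMap.polar Q x y ≠ 0) (h1 : QuadraticMap.polar Q x y ≠ -1) :
    1 + ι Q x * ι Q y ∈ scaledSpin Q := by
  set a := QuadraticMap.polar Q x y with ha
  have hadd : ∀ r s : ℂ, Q (r • x + s • y) = r * s * a := by
    intro r s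
    rw [QuadraticMap.map_add Q, QuadraticMap.map_smul, QuadraticMap.map_smul, hx, hy,
      QuadraticMap.polar_smul_left, QuadraticMap.polar_smul_right, ← ha]
    simp [mul_assoc]
  have hyx : ι Q y * ι Q x = algebraMap ℂ _ a - ι Q x * ι Q y := by
    rw [ι_mul_ι_comm, QuadraticMap.polar_comm]
  have hprod : 1 + ι Q x * ι Q y
      = ι Q ((1 : ℂ) • x + (1 : ℂ) • y) * ι Q (a⁻¹ • x + (1 + a⁻¹) • y) := by
    simp only [one_smul, map_add, map_smul, mul_add, add_mul, mul_smul_comm, ι_sq_scalar, hx, hy,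
      map_zero, hyx, Algebra.algebraMap_eq_smul_one, add_smul]
    match_scalars
    field_simp
    ring
  have h1' : a + 1 ≠ 0 := fun h => h1 (eq_neg_of_add_eq_zero_left h)
  rw [hprod]
  refine ι_mul_ι_mem_scaledSpin ?_ ?_
  · rw [hadd]
    simpa using h0
  · rw [hadd]
    have : a⁻¹ * (1 + a⁻¹) * a = (a + 1) / a := by field_simp
    rw [this]
    exact div_ne_zero h1' h0

theorem exists_polar_eq [FiniteDimensional ℂ V] (hQ : Q.polarBilin.Nondegenerate)
    (f : Module.Dual ℂ V) : ∃ v, ∀ w, QuadraticMap.polar Q v w = f w := by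
  obtain ⟨v, hv⟩ := (LinearMap.BilinForm.toDual Q.polarBilin hQ).surjective f
  exact ⟨v, fun w => by rw [← hv]; rfl⟩

/-- For isotropic vectors `x`, `y` with `⟨x, y⟩ ≠ -1`, the element `1 + x * y` is a multiple of an
element of the spin group. When `⟨x, y⟩ = 0`, it factors as `(1 + x * z) * (1 + x * w)` with
`⟨x, z⟩ = 1` and `w = (y - z) / 2`. -/
theorem one_add_ι_mul_ι_mem_scaledSpin [FiniteDimensional ℂ V] (hQ : Q.polarBilin.Nondegenerate)
    {x y : V} (hx : Q x = 0) (hy : Q y = 0) (h1 : QuadraticMap.polar Q x y ≠ -1) :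
    1 + ι Q x * ι Q y ∈ scaledSpin Q := by
  by_cases h0 : QuadraticMap.polar Q x y = 0
  swap
  · exact one_add_ι_mul_ι_mem_scaledSpin_of_polar_ne_zero hx hy h0 h1
  -- Proportional isotropic vectors have product zero; otherwise a functional separates them.
  by_cases hxy : x ∈ Submodule.span ℂ {y}
  · obtain ⟨c, rfl⟩ := Submodule.mem_span_singleton.1 hxy
    rw [map_smul, smul_mul_assoc, ι_sq_scalar, hy, map_zero, smul_zero, add_zero]
    exact one_mem _
  obtain ⟨f, hfx, hfy⟩ := Submodule.exists_le_ker_of_notMem hxy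
  have hfy' : f y = 0 := hfy (Submodule.mem_span_singleton_self y)
  obtain ⟨v, hv⟩ := exists_polar_eq hQ ((f x)⁻¹ • f)
  have hvx : QuadraticMap.polar Q v x = 1 := by rw [hv]; simp [hfx]
  have hvy : QuadraticMap.polar Q v y = 0 := by rw [hv]; simp [hfy']
  obtain ⟨z, hz, hzx, hzy⟩ : ∃ z, Q z = 0 ∧ QuadraticMap.polar Q x z = 1 ∧
      QuadraticMap.polar Q y z = 0 := by
    refine ⟨v - Q v • x, ?_, ?_, ?_⟩
    · rw [sub_eq_add_neg, ← neg_smul, QuadraticMap.map_add Q, QuadraticMap.map_smul,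
        QuadraticMap.polar_smul_right, hvx, hx]
      simp
    · rw [QuadraticMap.polar_sub_right, QuadraticMap.polar_smul_right, QuadraticMap.polar_comm, hvx,
        QuadraticMap.polar_self, hx]
      simp
    · rw [QuadraticMap.polar_sub_right, QuadraticMap.polar_smul_right, QuadraticMap.polar_comm, hvy,
        QuadraticMap.polar_comm, h0]
      simp
  have hw : Q ((2⁻¹ : ℂ) • (y - z)) = 0 := by
    rw [QuadraticMap.map_smul, sub_eq_add_neg, QuadraticMap.map_add Q, QuadraticMap.map_neg,
      QuadraticMap.polar_neg_right, hy, hz, hzy]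
    simp
  have hxw : QuadraticMap.polar Q x ((2⁻¹ : ℂ) • (y - z)) = -2⁻¹ := by
    rw [QuadraticMap.polar_smul_right, QuadraticMap.polar_sub_right, h0, hzx]
    simp
  have hprod : 1 + ι Q x * ι Q y
      = (1 + ι Q x * ι Q z) * (1 + ι Q x * ι Q ((2⁻¹ : ℂ) • (y - z))) := by
    have h : ι Q x * ι Q z * ι Q x = ι Q x := by
      rw [ι_mul_ι_mul_ι, hzx, hx, one_smul, zero_smul, sub_zero]
    have h2 : ι Q y = ι Q z + (2 : ℂ) • ι Q ((2⁻¹ : ℂ) • (y - z)) := by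
      rw [← map_smul, smul_smul, ← map_add]
      simp
    rw [mul_add, mul_one, ← mul_assoc, add_mul, one_mul, h, h2, two_smul, mul_add]
    simp only [add_mul, mul_add]
    abel
  rw [hprod]
  refine mul_mem (one_add_ι_mul_ι_mem_scaledSpin_of_polar_ne_zero hx hz ?_ ?_)
    (one_add_ι_mul_ι_mem_scaledSpin_of_polar_ne_zero hx hw ?_ ?_)
  · rw [hzx]; norm_num
  · rw [hzx]; norm_num
  · rw [hxw]; norm_num
  · rw [hxw]; norm_num

theorem mem_span_nonisotropic [Nontrivial V] (hQ : Q.polarBilin.Nondegenerate) (v : V) :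
    v ∈ Submodule.span ℂ {u | Q u ≠ 0} := by
  obtain ⟨u, hu⟩ : ∃ u, Q u ≠ 0 := by
    by_contra! hc
    obtain ⟨w, hw⟩ := exists_ne (0 : V)
    exact hw (hQ.1 w fun z => by simp [QuadraticMap.polar, hc])
  by_cases hv : Q v = 0
  swap
  · exact Submodule.subset_span hv
  have hsum : Q (v + u) + Q (v - u) = 2 * Q u := by
    rw [sub_eq_add_neg, QuadraticMap.map_add Q, QuadraticMap.map_add Q, QuadraticMap.map_neg,
      QuadraticMap.polar_neg_right, hv]
    ring
  have hu' : u ∈ Submodule.span ℂ {u | Q u ≠ 0} := Submodule.subset_span hu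
  by_cases h : Q (v + u) = 0
  · have h' : Q (v - u) ≠ 0 := by
      rw [h, zero_add] at hsum
      rw [hsum]
      exact mul_ne_zero two_ne_zero hu
    simpa using Submodule.add_mem _ (Submodule.subset_span h') hu'
  · simpa using Submodule.sub_mem _ (Submodule.subset_span h) hu'

/-- The spin group spans the even Clifford algebra. -/
theorem even_le_span_scaledSpin [Nontrivial V] (hQ : Q.polarBilin.Nondegenerate) :
    evenOdd Q 0 ≤ Submodule.span ℂ (scaledSpin Q : Set (CliffordAlgebra Q)) := by
  have hmul : ∀ x ∈ Submodule.span ℂ (scaledSpin Q : Set (CliffordAlgebra Q)), ∀ v w : V,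
      ι Q v * ι Q w * x ∈ Submodule.span ℂ (scaledSpin Q : Set (CliffordAlgebra Q)) := by
    intro x hx v w
    induction hx using Submodule.span_induction with
    | mem x hx =>
      induction mem_span_nonisotropic hQ v using Submodule.span_induction with
      | mem v hv =>
        induction mem_span_nonisotropic hQ w using Submodule.span_induction with
        | mem w hw => exact Submodule.subset_span (mul_mem (ι_mul_ι_mem_scaledSpin hv hw) hx)
        | zero => simp
        | add w w' _ _ h h' =>
          rw [map_add, mul_add, add_mul]
          exact Submodule.add_mem _ h h'
        | smul c w _ h =>
          rw [map_smul, mul_smul_comm, smul_mul_assoc]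
          exact Submodule.smul_mem _ _ h
      | zero => simp
      | add v v' _ _ h h' =>
        rw [map_add, add_mul, add_mul]
        exact Submodule.add_mem _ h h'
      | smul c v _ h =>
        rw [map_smul, smul_mul_assoc, smul_mul_assoc]
        exact Submodule.smul_mem _ _ h
    | zero => simp
    | add x y _ _ hx hy =>
      rw [mul_add]
      exact Submodule.add_mem _ hx hy
    | smul c x _ hx =>
      rw [mul_smul_comm]
      exact Submodule.smul_mem _ _ hx
  intro x hx
  induction x, hx using even_induction with
  | algebraMap r =>
    rw [Algebra.algebraMap_eq_smul_one]
    exact Submodule.smul_mem _ _ (Submodule.subset_span (one_mem _))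
  | add x y _ _ hx hy => exact Submodule.add_mem _ hx hy
  | ι_mul_ι_mul v w x _ hx => exact hmul x hx v w

end ScaledSpin

namespace Polarization

/-! ### The operators of `Spin(V) × ℂˣ` on spinors -/

section Operators

variable {V : Type*} [AddCommGroup V] [Module ℂ V] {Q : QuadraticForm ℂ V} (P : Polarization Q)

/-- The operators on the spinors given by the elements of `Spin(V) × ℂˣ`. -/
noncomputable def spinOperators : Submonoid (Module.End ℂ P.Spinor) :=
  (scaledSpin Q).map P.cliffordAction

variable {P}

theorem exists_spinOperators_mul_eq_one {k : Module.End ℂ P.Spinor} (hk : k ∈ P.spinOperators) :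
    ∃ k' ∈ P.spinOperators, k' * k = 1 ∧ k * k' = 1 := by
  obtain ⟨x, hx, rfl⟩ := hk
  obtain ⟨y, hy, hyx, hxy⟩ := exists_scaledSpin_mul_eq_one hx
  exact ⟨_, ⟨y, hy, rfl⟩, by rw [← map_one P.cliffordAction, ← hyx]; exact (map_mul _ _ _).symm,
    by rw [← map_one P.cliffordAction, ← hxy]; exact (map_mul _ _ _).symm⟩

theorem injective_of_mem_spinOperators {k : Module.End ℂ P.Spinor} (hk : k ∈ P.spinOperators) :
    Function.Injective k := by
  obtain ⟨k', -, h, -⟩ := exists_spinOperators_mul_eq_one hk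
  exact Function.LeftInverse.injective (g := k') fun x => LinearMap.congr_fun h x

theorem smul_one_mem_spinOperators {t : ℂ} (ht : t ≠ 0) :
    t • (1 : Module.End ℂ P.Spinor) ∈ P.spinOperators :=
  ⟨t • 1, ⟨Units.mk0 t ht, 1, by simp⟩, by simp⟩

theorem cliffordMul_coe (l : P.L) : P.cliffordMul (l : V) = P.contraction l := by
  have h1 : P.projL (l : V) = l := Submodule.projectionOnto_apply_left _ l
  have h2 : P.projL' (l : V) = 0 := Submodule.projectionOnto_apply_right P.isCompl.symm l
  refine LinearMap.ext fun ψ => ?_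
  rw [cliffordMul_apply, h1]
  simp [covector, h2]

theorem coe_projL_add_coe_projL' (v : V) : (P.projL v : V) + (P.projL' v : V) = v := by
  have h := Submodule.projection_add_projection_eq_self P.isCompl v
  rwa [← Submodule.coe_projectionOnto_apply, ← Submodule.coe_projectionOnto_apply] at h

theorem cliffordMul_eq_contraction_add_wedge (v : V) (ψ : P.Spinor) :
    P.cliffordMul v ψ = P.contraction (P.projL v) ψ + P.wedge (P.covector v) ψ := rfl

theorem covector_apply (v : V) (l : P.L) : P.covector v l = QuadraticMap.polar Q v l := by
  have h : QuadraticMap.polar Q (P.projL v : V) (l : V) = 0 := P.isotropic _ (P.projL v).2 _ l.2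
  conv_rhs => rw [← coe_projL_add_coe_projL' (P := P) v, QuadraticMap.polar_add_left, h, zero_add]
  rfl

theorem covector_eq_zero_iff (hQ : Q.polarBilin.Nondegenerate) {v : V} :
    P.covector v = 0 ↔ v ∈ P.L := by
  refine ⟨fun h => ?_, fun h => LinearMap.ext fun l => ?_⟩
  · have h' : (P.projL' v : V) = 0 := hQ.1 _ fun w => by
      rw [← coe_projL_add_coe_projL' (P := P) w, QuadraticMap.polarBilin_apply_apply,
        QuadraticMap.polar_add_right, P.isotropic' _ (P.projL' v).2 _ (P.projL' w).2, add_zero]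
      exact LinearMap.congr_fun h (P.projL w)
    rw [← coe_projL_add_coe_projL' (P := P) v, h', add_zero]
    exact (P.projL v).2
  · rw [covector_apply]
    exact P.isotropic _ h _ l.2

section FiniteDimensional

variable [FiniteDimensional ℂ V] (hQ : Q.polarBilin.Nondegenerate)

include hQ

/-- Every dual vector of `L` is represented by a vector of `L'`. -/
theorem exists_mem_covector_eq (α : Module.Dual ℂ P.L) :
    ∃ y ∈ P.L', P.covector y = α ∧ P.cliffordMul y = P.wedge α := by
  obtain ⟨v, hv⟩ := exists_polar_eq hQ (α ∘ₗ P.projL)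
  have hcov : P.covector (P.projL' v : V) = α := by
    have h : P.covector (P.projL v : V) = 0 := (covector_eq_zero_iff hQ).2 (P.projL v).2
    have h' : P.covector v = α := LinearMap.ext fun l => by
      rw [covector_apply, hv, LinearMap.comp_apply]
      exact congrArg α (Submodule.projectionOnto_apply_left _ l)
    have hadd := congrArg P.covector (coe_projL_add_coe_projL' (P := P) v)
    rw [← h', ← hadd, map_add, h, zero_add]
  refine ⟨P.projL' v, (P.projL' v).2, hcov, LinearMap.ext fun ψ => ?_⟩
  have h0 : P.projL (P.projL' v : V) = 0 := Submodule.projectionOnto_apply_right P.isCompl _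
  rw [cliffordMul_eq_contraction_add_wedge, h0, hcov, map_zero, LinearMap.zero_apply, zero_add]

theorem one_add_cliffordMul_mul_mem_spinOperators {x y : V} (hx : Q x = 0) (hy : Q y = 0)
    (h : QuadraticMap.polar Q x y ≠ -1) :
    1 + P.cliffordMul x * P.cliffordMul y ∈ P.spinOperators :=
  ⟨_, one_add_ι_mul_ι_mem_scaledSpin hQ hx hy h, by
    simp [cliffordAction_ι]⟩

theorem one_add_wedge_mul_contraction_mem {α : Module.Dual ℂ P.L} {l : P.L} (h : α l ≠ -1) :
    1 + P.wedge α * P.contraction l ∈ P.spinOperators := by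
  obtain ⟨y, hy, hα, hw⟩ := exists_mem_covector_eq hQ α
  rw [← hw, ← cliffordMul_coe]
  refine one_add_cliffordMul_mul_mem_spinOperators hQ (P.isotropic'.apply_eq_zero hy)
    (P.isotropic.apply_eq_zero l.2) ?_
  rwa [← covector_apply, hα]

theorem one_add_wedge_mul_wedge_mem (α β : Module.Dual ℂ P.L) :
    1 + P.wedge α * P.wedge β ∈ P.spinOperators := by
  obtain ⟨y, hy, -, hα⟩ := exists_mem_covector_eq hQ α
  obtain ⟨z, hz, -, hβ⟩ := exists_mem_covector_eq hQ β
  rw [← hα, ← hβ]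
  refine one_add_cliffordMul_mul_mem_spinOperators hQ (P.isotropic'.apply_eq_zero hy)
    (P.isotropic'.apply_eq_zero hz) ?_
  rw [P.isotropic' _ hy _ hz]
  norm_num

theorem one_add_contraction_mul_contraction_mem (l m : P.L) :
    1 + P.contraction l * P.contraction m ∈ P.spinOperators := by
  rw [← cliffordMul_coe, ← cliffordMul_coe]
  refine one_add_cliffordMul_mul_mem_spinOperators hQ (P.isotropic.apply_eq_zero l.2)
    (P.isotropic.apply_eq_zero m.2) ?_
  rw [P.isotropic _ l.2 _ m.2]
  norm_num

end FiniteDimensional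

variable (P) in
/-- The vectors that kill a spinor form a maximal isotropic subspace. This is `IsPure`, for spinors
of any chirality. -/
def IsPureSpinor (ψ : P.Spinor) : Prop :=
  Maximal (IsIsotropic Q) (LinearMap.ker (P.cliffordMul.flip ψ))

theorem isPure_iff {ψ : P.SPlus} : P.IsPure ψ ↔ P.IsPureSpinor (ψ : P.Spinor) := Iff.rfl

theorem IsPureSpinor.ne_zero [Nontrivial V] (hQ : Q.polarBilin.Nondegenerate) {ψ : P.Spinor}
    (h : P.IsPureSpinor ψ) : ψ ≠ 0 := by
  rintro rfl
  obtain ⟨w, hw⟩ := exists_ne (0 : V)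
  exact hw (hQ.1 w fun z => h.1 w (by simp) z (by simp))

/-- An element of the spin group moves the annihilator of a spinor by an isometry of `V`, so that
it preserves purity. -/
theorem IsPureSpinor.map {ψ : P.Spinor} (h : P.IsPureSpinor ψ) {k : Module.End ℂ P.Spinor}
    (hk : k ∈ P.spinOperators) : P.IsPureSpinor (k ψ) := by
  obtain ⟨_, ⟨t, g, rfl⟩, rfl⟩ := hk
  obtain ⟨ρ, hρ, hconj⟩ := exists_isometry_of_mem_spinGroup g
  have hinj : ∀ φ, P.cliffordAction (g : CliffordAlgebra Q) φ = 0 → φ = 0 := fun φ hφ =>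
    injective_of_mem_spinOperators (P := P) ⟨g, ⟨1, g, by simp⟩, rfl⟩ (by simpa using hφ)
  have hmem : ∀ v, ρ v ∈ LinearMap.ker (P.cliffordMul.flip
      (P.cliffordAction ((t : ℂ) • (g : CliffordAlgebra Q)) ψ)) ↔
      v ∈ LinearMap.ker (P.cliffordMul.flip ψ) := by
    intro v
    have h1 := LinearMap.congr_fun (congrArg P.cliffordAction (hconj v)) ψ
    rw [map_mul, map_mul, cliffordAction_ι, cliffordAction_ι, Module.End.mul_apply,
      Module.End.mul_apply] at h1
    rw [LinearMap.mem_ker, LinearMap.mem_ker, LinearMap.flip_apply, LinearMap.flip_apply, map_smul,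
      LinearMap.smul_apply, map_smul, smul_eq_zero_iff_right t.ne_zero, h1]
    exact ⟨hinj _, fun h0 => by rw [h0, map_zero]⟩
  have hpolar : ∀ v w, QuadraticMap.polar Q (ρ v) (ρ w) = QuadraticMap.polar Q v w := fun v w => by
    simp only [QuadraticMap.polar, ← map_add, hρ]
  refine ⟨fun x hx y hy => ?_, fun N hN hle x hx => ?_⟩
  · obtain ⟨v, rfl⟩ := ρ.surjective x
    obtain ⟨w, rfl⟩ := ρ.surjective y
    rw [hpolar]
    exact h.1 _ ((hmem v).1 hx) _ ((hmem w).1 hy)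
  · obtain ⟨v, rfl⟩ := ρ.surjective x
    refine (hmem v).2 (h.2 (y := N.comap (ρ : V →ₗ[ℂ] V)) (fun a ha b hb => ?_) (fun a ha => ?_) hx)
    · rw [← hpolar]
      exact hN _ ha _ hb
    · exact hle ((hmem a).2 ha)

theorem isPureSpinor_one (hQ : Q.polarBilin.Nondegenerate) : P.IsPureSpinor 1 := by
  have hker : LinearMap.ker (P.cliffordMul.flip (1 : P.Spinor)) = P.L := by
    ext v
    rw [LinearMap.mem_ker, LinearMap.flip_apply, cliffordMul_eq_contraction_add_wedge,
      contraction_one, zero_add, wedge_apply, mul_one, ExteriorAlgebra.ι_eq_zero_iff,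
      covector_eq_zero_iff hQ]
  rw [IsPureSpinor, hker]
  refine ⟨P.isotropic, fun N hN hle x hx => ?_⟩
  rw [← covector_eq_zero_iff hQ]
  ext l
  rw [covector_apply]
  exact hN x hx l (hle l.2)

end Operators

/-! ### Transitivity on pure spinors -/

section PureSpinor

variable {V : Type*} [AddCommGroup V] [Module ℂ V] {Q : QuadraticForm ℂ V} {P : Polarization Q}

theorem scalarPart_eq_zero_of_mem_odd {ψ : P.Spinor} (hψ : ψ ∈ CliffordAlgebra.evenOdd 0 1) :
    P.scalarPart ψ = 0 := by
  have h : P.scalarPart.comp CliffordAlgebra.involute = P.scalarPart := by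
    apply ExteriorAlgebra.hom_ext
    ext α
    change P.scalarPart (CliffordAlgebra.involute (CliffordAlgebra.ι 0 α))
      = P.scalarPart (CliffordAlgebra.ι 0 α)
    have h0 : P.scalarPart (CliffordAlgebra.ι 0 α) = 0 := by
      simpa [wedge_apply] using scalarPart_wedge (P := P) α 1
    rw [CliffordAlgebra.involute_ι, map_neg, h0, neg_zero]
  have h1 := DFunLike.congr_fun h ψ
  rw [AlgHom.comp_apply, CliffordAlgebra.involute_eq_of_mem_odd hψ, map_neg] at h1
  exact self_eq_neg.1 h1.symm

variable (P) in
/-- The contractions of `ψ` are the exterior products of `ψ` with dual vectors: the annihilator of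
`ψ` projects onto `L`. -/
def IsGraph (ψ : P.Spinor) : Prop := ∀ l, ∃ α, P.contraction l ψ = P.wedge α ψ

theorem isGraph_one : P.IsGraph 1 := fun l => ⟨0, by simp [contraction_one, wedge_apply]⟩

theorem contraction_add_wedge_wedge (α β : Module.Dual ℂ P.L) (l : P.L) (ψ : P.Spinor) :
    P.contraction l (ψ + P.wedge α (P.wedge β ψ))
      = P.wedge (α l • β - β l • α) ψ + (P.contraction l ψ
        + P.wedge α (P.wedge β (P.contraction l ψ))) := by
  simp only [map_add, contraction_wedge, wedge_sub, wedge_smul, map_sub, map_smul]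
  abel

theorem IsGraph.add_wedge_wedge {ψ : P.Spinor} (h : P.IsGraph ψ) (α β : Module.Dual ℂ P.L) :
    P.IsGraph (ψ + P.wedge α (P.wedge β ψ)) := by
  intro l
  obtain ⟨γ, hγ⟩ := h l
  refine ⟨α l • β - β l • α + γ, ?_⟩
  rw [contraction_add_wedge_wedge, hγ]
  simp only [wedge_add, wedge_sub, wedge_smul, map_add, wedge_wedge_self, map_zero,
    wedge_comm β α, map_neg, wedge_comm γ α, wedge_comm γ β, neg_neg, smul_zero, neg_zero, sub_self]
  abel

variable (P) in
/-- The component of degree two of a spinor, as a form on `L`. -/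
def formPart (ψ : P.Spinor) (m l : P.L) : ℂ :=
  P.scalarPart (P.contraction m (P.contraction l ψ))

theorem formPart_add_wedge_wedge (α β : Module.Dual ℂ P.L) (m l : P.L) (ψ : P.Spinor) :
    P.formPart (ψ + P.wedge α (P.wedge β ψ)) m l
      = P.formPart ψ m l + (α l * β m - β l * α m) * P.scalarPart ψ := by
  rw [formPart, contraction_add_wedge_wedge]
  simp only [map_add, contraction_wedge, map_sub, map_smul, scalarPart_wedge, formPart]
  simp
  ring

theorem formPart_comm (ψ : P.Spinor) (m l : P.L) : P.formPart ψ m l = -P.formPart ψ l m := by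
  rw [formPart, contraction_comm, map_neg]
  rfl

variable [FiniteDimensional ℂ V]

/-- Contracting, one after the other, with those vectors of a basis of `L` that do not kill the
result turns a nonzero spinor into a nonzero scalar. -/
theorem exists_even_scalarPart_ne_zero {ψ : P.Spinor} (hψ : ψ ∈ P.evenPart) (h0 : ψ ≠ 0) :
    ∃ x ∈ CliffordAlgebra.evenOdd Q 0, P.scalarPart (P.cliffordAction x ψ) ≠ 0 := by
  classical
  let b := Module.finBasis ℂ P.L
  have key : ∀ s : Finset (Fin (Module.finrank ℂ P.L)), ∃ i : ZMod 2,
      ∃ x ∈ CliffordAlgebra.evenOdd Q i, P.cliffordAction x ψ ∈ CliffordAlgebra.evenOdd 0 i ∧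
        P.cliffordAction x ψ ≠ 0 ∧ ∀ j ∈ s, P.contraction (b j) (P.cliffordAction x ψ) = 0 := by
    intro s
    induction s using Finset.induction_on with
    | empty =>
      refine ⟨0, 1, ?_, ?_, ?_, by simp⟩
      · exact CliffordAlgebra.one_le_evenOdd_zero Q (Submodule.mem_one.2 ⟨1, map_one _⟩)
      · rw [map_one, Module.End.one_apply, ← evenPart_eq]
        exact hψ
      · rwa [map_one, Module.End.one_apply]
    | insert j s _ ih =>
      obtain ⟨i, x, hx, hxψ, hne, hs⟩ := ih
      by_cases hj : P.contraction (b j) (P.cliffordAction x ψ) = 0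
      · refine ⟨i, x, hx, hxψ, hne, fun j' hj' => ?_⟩
        obtain rfl | hj' := Finset.mem_insert.1 hj'
        · exact hj
        · exact hs j' hj'
      · have hact : P.cliffordAction (CliffordAlgebra.ι Q (b j : V) * x) ψ
            = P.contraction (b j) (P.cliffordAction x ψ) := by
          rw [map_mul, Module.End.mul_apply, cliffordAction_ι, cliffordMul_coe]
        refine ⟨i + 1, CliffordAlgebra.ι Q (b j : V) * x, ?_, ?_, ?_, fun j' hj' => ?_⟩
        · rw [add_comm]
          exact CliffordAlgebra.evenOdd_mul_le _ _ _
            (Submodule.mul_mem_mul (CliffordAlgebra.ι_mem_evenOdd_one _ _) hx)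
        · rw [hact]
          exact contractLeft_mem _ hxψ
        · rwa [hact]
        · rw [hact]
          obtain rfl | hj' := Finset.mem_insert.1 hj'
          · exact contraction_self _ _
          · rw [contraction_comm, hs j' hj', map_zero, neg_zero]
  obtain ⟨i, x, hx, hxψ, hne, hs⟩ := key Finset.univ
  have hzero : ∀ l, P.contraction l (P.cliffordAction x ψ) = 0 := fun l => by
    have : (P.contraction.flip (P.cliffordAction x ψ)) = 0 :=
      b.ext fun j => hs j (Finset.mem_univ j)
    exact LinearMap.congr_fun this l
  have hscalar : P.scalarPart (P.cliffordAction x ψ) ≠ 0 := fun h => by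
    obtain ⟨l, hl⟩ := exists_contraction_ne_zero hne h
    exact hl (hzero l)
  obtain rfl | rfl : i = 0 ∨ i = 1 := (by decide : ∀ i : ZMod 2, i = 0 ∨ i = 1) i
  · exact ⟨x, hx, hscalar⟩
  · exact absurd (scalarPart_eq_zero_of_mem_odd hxψ) hscalar

theorem exists_spinOperators_scalarPart_ne_zero [Nontrivial V] (hQ : Q.polarBilin.Nondegenerate)
    {ψ : P.Spinor} (hψ : ψ ∈ P.evenPart) (h0 : ψ ≠ 0) :
    ∃ k ∈ P.spinOperators, P.scalarPart (k ψ) ≠ 0 := by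
  obtain ⟨x, hx, hne⟩ := exists_even_scalarPart_ne_zero hψ h0
  by_contra! hc
  let f : CliffordAlgebra Q →ₗ[ℂ] ℂ := P.scalarPart.toLinearMap ∘ₗ
    LinearMap.applyₗ ψ ∘ₗ P.cliffordAction.toLinearMap
  have hf : Submodule.span ℂ (scaledSpin Q : Set (CliffordAlgebra Q)) ≤ LinearMap.ker f :=
    Submodule.span_le.2 fun x hx => hc _ ⟨x, hx, rfl⟩
  exact hne (hf (even_le_span_scaledSpin hQ hx))

/-- The operators `1 + α ∧ β ∧ -` add an arbitrary two-form to a spinor with scalar part `1`. -/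
theorem exists_formPart_eq_add (hQ : Q.polarBilin.Nondegenerate) {ω : P.L → P.L → ℂ}
    (hω : ω ∈ AddSubmonoid.closure {ω | ∃ α β : Module.Dual ℂ P.L,
      ω = fun m l => α l * β m - β l * α m}) :
    ∀ {ψ : P.Spinor}, P.scalarPart ψ = 1 → ∃ k ∈ P.spinOperators, P.scalarPart (k ψ) = 1 ∧
      (∀ m l, P.formPart (k ψ) m l = P.formPart ψ m l + ω m l) ∧
      (P.IsGraph (k ψ) → P.IsGraph ψ) := by
  induction hω using AddSubmonoid.closure_induction with
  | mem ω h =>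
    obtain ⟨α, β, rfl⟩ := h
    intro ψ hψ
    refine ⟨_, one_add_wedge_mul_wedge_mem hQ α β, ?_, fun m l => ?_, fun h => ?_⟩
    · simpa using hψ
    · have := formPart_add_wedge_wedge α β m l ψ
      rwa [hψ, mul_one] at this
    · -- The operator given by `-α` and `β` is the inverse of the one given by `α` and `β`.
      have := h.add_wedge_wedge (-α) β
      simpa [neg_wedge, wedge_wedge_self, wedge_comm β α] using this
  | zero => exact fun hψ => ⟨1, one_mem _, hψ, by simp, id⟩
  | add ω ω' _ _ h h' =>
    intro ψ hψ
    obtain ⟨k, hk, h1, h2, h3⟩ := h hψ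
    obtain ⟨k', hk', h1', h2', h3'⟩ := h' h1
    refine ⟨k' * k, mul_mem hk' hk, h1', fun m l => ?_, fun hg => h3 (h3' hg)⟩
    rw [Module.End.mul_apply, h2', h2, add_assoc]
    rfl

theorem neg_formPart_mem_closure (ψ : P.Spinor) :
    (fun m l => -P.formPart ψ m l) ∈ AddSubmonoid.closure {ω : P.L → P.L → ℂ |
      ∃ α β : Module.Dual ℂ P.L, ω = fun m l => α l * β m - β l * α m} := by
  let b := Module.finBasis ℂ P.L
  let B : P.L →ₗ[ℂ] P.L →ₗ[ℂ] ℂ := LinearMap.mk₂ ℂ (P.formPart ψ) (by simp [formPart])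
    (by simp [formPart]) (by simp [formPart]) (by simp [formPart])
  have hB : ∀ m l, P.formPart ψ m l
      = ∑ i, ∑ j, b.coord i m * b.coord j l * P.formPart ψ (b i) (b j) := fun m l => by
    change B m l = ∑ i, ∑ j, b.coord i m * b.coord j l * B (b i) (b j)
    rw [← LinearMap.sum_repr_mul_repr_mul b b (B := B) m l]
    simp [Finsupp.sum_fintype, mul_assoc]
  -- The sum runs over all ordered pairs of indices, hence the factor `1 / 2`.
  have : (fun m l => -P.formPart ψ m l) = ∑ i, ∑ j, fun m l : P.L =>
      b.coord i l * ((2⁻¹ * P.formPart ψ (b i) (b j)) • b.coord j) m -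
        ((2⁻¹ * P.formPart ψ (b i) (b j)) • b.coord j) l * b.coord i m := by
    ext m l
    have h1 := hB m l
    have h2 := hB l m
    rw [formPart_comm] at h2
    have h3 : -P.formPart ψ m l = 2⁻¹ * (-P.formPart ψ m l) - 2⁻¹ * P.formPart ψ m l := by ring
    rw [h3, h2]
    nth_rw 1 [h1]
    simp only [Finset.mul_sum, ← Finset.sum_sub_distrib, Finset.sum_apply]
    refine Finset.sum_congr rfl fun i _ => Finset.sum_congr rfl fun j _ => ?_
    simp only [LinearMap.smul_apply, smul_eq_mul]
    ring
  rw [this]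
  exact sum_mem fun i _ => sum_mem fun j _ => AddSubmonoid.subset_closure ⟨_, _, rfl⟩

/-- A pure spinor without form part is a scalar: its annihilator is contained in `L`, hence equal
to `L`. -/
theorem IsPureSpinor.eq_one {ψ : P.Spinor} (h : P.IsPureSpinor ψ) (h1 : P.scalarPart ψ = 1)
    (h2 : ∀ m l, P.formPart ψ m l = 0) (hQ : Q.polarBilin.Nondegenerate) : ψ = 1 := by
  have hle : LinearMap.ker (P.cliffordMul.flip ψ) ≤ P.L := by
    intro v hv
    rw [LinearMap.mem_ker, LinearMap.flip_apply, cliffordMul_eq_contraction_add_wedge] at hv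
    rw [← covector_eq_zero_iff hQ]
    ext m
    -- The component of degree one of `v · ψ = 0` says that the component of `v` in `L'` vanishes.
    have := congrArg (fun φ => P.scalarPart (P.contraction m φ)) hv
    simp only [map_add, contraction_wedge, map_sub, map_smul, scalarPart_wedge, h1, map_zero,
      sub_zero] at this
    have h2' := h2 m (P.projL v)
    rw [formPart] at h2'
    simpa [h2'] using this
  have hL : ∀ l, P.contraction l ψ = 0 := fun l => by
    have := h.2 P.isotropic hle l.2
    rwa [LinearMap.mem_ker, LinearMap.flip_apply, cliffordMul_coe] at this
  rw [eq_algebraMap_of_contraction_eq_zero hL, h1, map_one]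

/-- A pure spinor with scalar part `1` is moved to `1` by exterior products. -/
theorem IsPureSpinor.exists_eq_one (hQ : Q.polarBilin.Nondegenerate) {ψ : P.Spinor}
    (h : P.IsPureSpinor ψ) (h1 : P.scalarPart ψ = 1) :
    P.IsGraph ψ ∧ ∃ k ∈ P.spinOperators, k ψ = 1 := by
  obtain ⟨k, hk, hk1, hk2, hk3⟩ := exists_formPart_eq_add hQ (neg_formPart_mem_closure ψ) h1
  have hone : k ψ = 1 := (h.map hk).eq_one hk1 (fun m l => by rw [hk2, add_neg_cancel]) hQ
  exact ⟨hk3 (hone ▸ isGraph_one), k, hk, hone⟩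

/-- The group `Spin(V) × ℂˣ` acts transitively on the pure spinors of positive chirality. -/
theorem IsPureSpinor.exists_spinOperators_eq_one [Nontrivial V] (hQ : Q.polarBilin.Nondegenerate)
    {ψ : P.Spinor} (h : P.IsPureSpinor ψ) (hψ : ψ ∈ P.evenPart) :
    ∃ k ∈ P.spinOperators, k ψ = 1 := by
  obtain ⟨k, hk, hne⟩ := exists_spinOperators_scalarPart_ne_zero hQ hψ (h.ne_zero hQ)
  have hk' := mul_mem (smul_one_mem_spinOperators (P := P) (inv_ne_zero hne)) hk
  obtain ⟨-, k', hk'', h1⟩ := (h.map hk').exists_eq_one hQ (by simp [hne])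
  exact ⟨k' * _, mul_mem hk'' hk', h1⟩

end PureSpinor

/-! ### Planes of pure spinors -/

section PurePlane

variable {V : Type*} [AddCommGroup V] [Module ℂ V] {Q : QuadraticForm ℂ V} {P : Polarization Q}

/-- Suppose that `η` has no scalar part and that each contraction `l ⌟ (1 + s • η)` is an exterior
product `λ ∧ (1 + s • η)`. Its component of degree one shows that `λ` is linear in `s`, and then a
comparison of `s = 1` with `s = 2` shows that `l ⌟ η` is a dual vector with `(l ⌟ η) ∧ η = 0`. -/
theorem exists_contraction_eq_wedge_one {η : P.Spinor} (h0 : P.scalarPart η = 0)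
    (h : ∀ s : ℂ, P.IsGraph (1 + s • η)) (l : P.L) :
    ∃ α, P.contraction l η = P.wedge α 1 ∧ P.wedge α η = 0 := by
  have key : ∀ s : ℂ, ∃ α, s • P.contraction l η = P.wedge α (1 + s • η) ∧
      ∀ m, α m = s * P.formPart η m l := by
    intro s
    obtain ⟨α, hα⟩ := h s l
    rw [map_add, contraction_one, zero_add, map_smul] at hα
    refine ⟨α, hα, fun m => ?_⟩
    -- The components of degree one of both sides.
    have := congrArg (fun φ => P.scalarPart (P.contraction m φ)) hα
    simp only [contraction_wedge, map_sub, scalarPart_wedge, map_smul, map_add, h0, map_one] at this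
    simpa [formPart] using this.symm
  obtain ⟨α, hα, hα'⟩ := key 1
  obtain ⟨β, hβ, hβ'⟩ := key 2
  have hβα : β = (2 : ℂ) • α := LinearMap.ext fun m => by simp [hα', hβ']
  rw [hβα, wedge_smul] at hβ
  have hβ2 := smul_right_injective P.Spinor (two_ne_zero (α := ℂ)) hβ
  simp only [one_smul, map_add, two_smul] at hα hβ2
  have hz : P.wedge α η = 0 := by
    rw [hα] at hβ2
    simpa using hβ2
  exact ⟨α, by rw [hα, hz, add_zero], hz⟩

theorem exists_apply_ne_zero_of_wedge_ne_zero {α : Module.Dual ℂ P.L} {ψ : P.Spinor}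
    (h : P.wedge α ψ ≠ 0) : ∃ l, α l ≠ 0 := by
  by_contra! hc
  apply h
  rw [LinearMap.ext hc (g := 0)]
  simp [wedge_apply]

variable [FiniteDimensional ℂ V]

/-- A plane of pure spinors containing `1` is spanned by `1` and a product of two dual vectors. -/
theorem exists_eq_algebraMap_add_wedge_wedge [Nontrivial V] (hQ : Q.polarBilin.Nondegenerate)
    {χ : P.Spinor} (h : ∀ a b : ℂ, a ≠ 0 ∨ b ≠ 0 → P.IsPureSpinor (a • 1 + b • χ)) :
    ∃ (c : ℂ) (α β : Module.Dual ℂ P.L), P.wedge α (P.wedge β 1) ≠ 0 ∧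
      χ = c • 1 + P.wedge α (P.wedge β 1) := by
  set c := P.scalarPart χ with hc
  obtain ⟨η, hη⟩ : ∃ η, η = (-c) • (1 : P.Spinor) + (1 : ℂ) • χ := ⟨_, rfl⟩
  have hχ : χ = c • 1 + η := by rw [hη]; simp
  have hη0 : η ≠ 0 := hη ▸ (h (-c) 1 (Or.inr one_ne_zero)).ne_zero hQ
  have hscalar : P.scalarPart η = 0 := by rw [hη]; simp [← hc]
  have hgraph : ∀ s : ℂ, P.IsGraph (1 + s • η) := by
    intro s
    have hs : (1 : P.Spinor) + s • η = (1 - s * c) • 1 + s • χ := by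
      rw [hη]
      module
    have hp : P.IsPureSpinor (1 + s • η) := by
      rw [hs]
      refine h _ _ ?_
      by_cases hs0 : s = 0
      · exact Or.inl (by simp [hs0])
      · exact Or.inr hs0
    exact (hp.exists_eq_one hQ (by simp [hscalar])).1
  choose B hB hB' using exists_contraction_eq_wedge_one hscalar hgraph
  obtain ⟨l, hl⟩ := exists_contraction_ne_zero hη0 hscalar
  obtain ⟨m, hm⟩ : ∃ m, B l m ≠ 0 := by
    by_contra! hc
    apply hl
    rw [hB, LinearMap.ext hc (g := 0)]
    simp [wedge_apply]
  have hηB : η = P.wedge ((B l m)⁻¹ • B l) (P.wedge (B m) 1) := by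
    have h1 := congrArg (P.contraction m) (hB' l)
    rw [contraction_wedge, map_zero, hB, sub_eq_zero] at h1
    rw [wedge_smul, ← h1, smul_smul, inv_mul_cancel₀ hm, one_smul]
  exact ⟨c, _, _, hηB ▸ hη0, hηB ▸ hχ⟩

theorem exists_mem_apply_ne_zero {E : Type*} [AddCommGroup E] [Module ℂ E] (N : Submodule ℂ E)
    {f g : Module.Dual ℂ E} (hf : ∃ x ∈ N, f x ≠ 0) (hg : ∃ x ∈ N, g x ≠ 0) :
    ∃ x ∈ N, f x = 1 ∧ g x ≠ 0 := by
  suffices h : ∃ x ∈ N, f x ≠ 0 ∧ g x ≠ 0 by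
    obtain ⟨x, hx, hfx, hgx⟩ := h
    exact ⟨(f x)⁻¹ • x, N.smul_mem _ hx, by simp [hfx], by simp [hfx, hgx]⟩
  obtain ⟨x, hx, hfx⟩ := hf
  obtain ⟨y, hy, hgy⟩ := hg
  by_cases hgx : g x = 0
  · by_cases hfy : f y = 0
    · exact ⟨x + y, N.add_mem hx hy, by simpa [hfy], by simpa [hgx]⟩
    · exact ⟨y, hy, hfy, hgy⟩
  · exact ⟨x, hx, hfx, hgx⟩

/-- If `α` and `α'` do not vanish on a subspace `N` of `L`, then `α` can be moved to `α'` by adding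
to the dual vectors `γ` the multiples `γ l • (α' - α)`, for a vector `l` of `N` with `α l = 1`. -/
theorem exists_spinOperators_add_smul (hQ : Q.polarBilin.Nondegenerate)
    (N : Submodule ℂ P.L) {α α' : Module.Dual ℂ P.L} (h : ∃ l ∈ N, α l ≠ 0)
    (h' : ∃ l ∈ N, α' l ≠ 0) :
    ∃ k ∈ P.spinOperators, ∃ l ∈ N, α l = 1 ∧ k 1 = 1 ∧ ∀ γ δ : Module.Dual ℂ P.L,
      k (P.wedge γ (P.wedge δ 1))
        = P.wedge (γ + γ l • (α' - α)) (P.wedge (δ + δ l • (α' - α)) 1) := by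
  obtain ⟨l, hl, h1, h2⟩ := exists_mem_apply_ne_zero N h h'
  refine ⟨_, one_add_wedge_mul_contraction_mem hQ (α := α' - α) (l := l) ?_, l, hl, h1, ?_, ?_⟩
  · rw [LinearMap.sub_apply, h1]
    intro h0
    apply h2
    linear_combination h0
  · simp [contraction_one]
  · intro γ δ
    generalize α' - α = ε
    simp [contraction_wedge, contraction_one, wedge_add, wedge_smul, wedge_wedge_self,
      wedge_comm ε γ]
    abel

/-- The stabilizer of `1` acts transitively on the nonzero products of two dual vectors: the first
factor is moved to its target by adding multiples of a dual vector, and then the second one in the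
same way, with multiplicities given by a vector that the first factor kills. -/
theorem exists_spinOperators_wedge_eq (hQ : Q.polarBilin.Nondegenerate)
    {α β α' β' : Module.Dual ℂ P.L} (h : P.wedge α (P.wedge β 1) ≠ 0)
    (h' : P.wedge α' (P.wedge β' 1) ≠ 0) :
    ∃ k ∈ P.spinOperators, k 1 = 1 ∧ k (P.wedge α (P.wedge β 1)) = P.wedge α' (P.wedge β' 1) := by
  obtain ⟨l₁, h₁⟩ := exists_apply_ne_zero_of_wedge_ne_zero h
  obtain ⟨l₂, h₂⟩ := exists_apply_ne_zero_of_wedge_ne_zero h'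
  obtain ⟨k, hk, l, -, hl, hk1, hkw⟩ := exists_spinOperators_add_smul hQ ⊤
    ⟨l₁, trivial, h₁⟩ ⟨l₂, trivial, h₂⟩
  have hkαβ := hkw α β
  rw [hl, one_smul, add_sub_cancel] at hkαβ
  set δ := β + β l • (α' - α)
  have hδ : P.wedge α' (P.wedge δ 1) ≠ 0 := by
    rw [← hkαβ]
    exact fun h0 => h (injective_of_mem_spinOperators hk (by rw [h0, map_zero]))
  obtain ⟨k', hk', m, hm, hδm, hk1', hkw'⟩ := exists_spinOperators_add_smul hQ
    (LinearMap.ker α') (exists_apply_eq_zero_of_wedge_ne_zero hδ)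
    (exists_apply_eq_zero_of_wedge_ne_zero h')
  refine ⟨k' * k, mul_mem hk' hk, by rw [Module.End.mul_apply, hk1, hk1'], ?_⟩
  rw [Module.End.mul_apply, hkαβ, hkw', LinearMap.mem_ker.1 hm, hδm, zero_smul, add_zero, one_smul,
    add_sub_cancel]

/-- The operators `1 + l ⌟ (m ⌟ -)` fix `1` and change the scalar part of a product of two dual
vectors. -/
theorem exists_spinOperators_smul_one_add (hQ : Q.polarBilin.Nondegenerate) (c : ℂ)
    {α β : Module.Dual ℂ P.L} (h : P.wedge α (P.wedge β 1) ≠ 0) :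
    ∃ k ∈ P.spinOperators, k 1 = 1 ∧
      k (c • 1 + P.wedge α (P.wedge β 1)) = P.wedge α (P.wedge β 1) := by
  obtain ⟨l, hαl, hβl⟩ := exists_apply_eq_zero_of_wedge_ne_zero h
  obtain ⟨m, hm⟩ := exists_apply_ne_zero_of_wedge_ne_zero h
  refine ⟨_, one_add_contraction_mul_contraction_mem hQ ((-c / (α m * β l)) • l) m, ?_, ?_⟩
  · simp [contraction_one]
  · have h0 : -c / (α m * β l) * (α m * β l) = -c := div_mul_cancel₀ _ (mul_ne_zero hm hβl)
    simp [contraction_wedge, contraction_one, hαl, smul_smul, h0]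

/-- The group `Spin(V) × ℂˣ` acts transitively on the bases of planes of pure spinors of positive
chirality. -/
theorem exists_spinOperators_pair [Nontrivial V] (hQ : Q.polarBilin.Nondegenerate)
    {ψ₁ ψ₂ : P.Spinor} (h₁ : ψ₁ ∈ P.evenPart)
    (h : ∀ a b : ℂ, a ≠ 0 ∨ b ≠ 0 → P.IsPureSpinor (a • ψ₁ + b • ψ₂))
    {α β : Module.Dual ℂ P.L} (hαβ : P.wedge α (P.wedge β 1) ≠ 0) :
    ∃ k ∈ P.spinOperators, k ψ₁ = 1 ∧ k ψ₂ = P.wedge α (P.wedge β 1) := by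
  have hp : P.IsPureSpinor ψ₁ := by simpa using h 1 0 (Or.inl one_ne_zero)
  obtain ⟨k, hk, hk1⟩ := hp.exists_spinOperators_eq_one hQ h₁
  obtain ⟨c, α', β', hne, hχ⟩ := exists_eq_algebraMap_add_wedge_wedge hQ (χ := k ψ₂)
    fun a b hab => by simpa [hk1] using (h a b hab).map hk
  obtain ⟨k', hk', hk1', hkc⟩ := exists_spinOperators_smul_one_add hQ c hne
  obtain ⟨k'', hk'', hk1'', hkw⟩ := exists_spinOperators_wedge_eq hQ hne hαβ
  refine ⟨k'' * (k' * k), mul_mem hk'' (mul_mem hk' hk), ?_, ?_⟩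
  · simp [hk1, hk1', hk1'']
  · simp [hχ, -map_add, hkc, hkw]

/-- The spinors `1` and `α ∧ β` span a plane of pure spinors. -/
theorem isPureSpinor_smul_one_add_smul_wedge (hQ : Q.polarBilin.Nondegenerate)
    {α β : Module.Dual ℂ P.L} (hαβ : P.wedge α (P.wedge β 1) ≠ 0) {a b : ℂ} (hab : a ≠ 0 ∨ b ≠ 0) :
    P.IsPureSpinor (a • 1 + b • P.wedge α (P.wedge β 1)) := by
  have key : ∀ c : ℂ, P.IsPureSpinor ((1 : ℂ) • 1 + c • P.wedge α (P.wedge β 1)) := fun c => by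
    have := (isPureSpinor_one (P := P) hQ).map (one_add_wedge_mul_wedge_mem hQ (c • α) β)
    simpa [wedge_smul] using this
  by_cases ha : a = 0
  · have hb : b ≠ 0 := hab.resolve_left (not_not.2 ha)
    -- A group element removes the scalar part of the pure spinor `1 + α ∧ β`.
    obtain ⟨k, hk, -, hkw⟩ := exists_spinOperators_smul_one_add hQ 1 hαβ
    have := ((key 1).map hk).map (smul_one_mem_spinOperators hb)
    rw [one_smul ℂ (P.wedge α _), hkw] at this
    simpa [ha] using this
  · have := (key (b / a)).map (smul_one_mem_spinOperators ha)
    simpa [smul_smul, mul_div_cancel₀ _ ha] using this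

end PurePlane

end Polarization

/-! ### Linear families of pure spinors -/

section PureMap

open Polarization

variable {V : Type*} [AddCommGroup V] [Module ℂ V] {Q : QuadraticForm ℂ V} {P : Polarization Q}
variable {W : Type*} [AddCommGroup W] [Module ℂ W] {q : QuadraticForm ℂ W}

/-- A linear map from the dual of `W` to `S_+` all of whose nonzero values are pure. Both the pairs
`(U, φ)` and the supercharges of the theorem amount to such maps. -/
def IsPureMap (F : Module.Dual ℂ W →ₗ[ℂ] P.SPlus) : Prop := ∀ f, f ≠ 0 → P.IsPure (F f)

theorem IsPureMap.injective [Nontrivial V] (hQ : Q.polarBilin.Nondegenerate)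
    {F : Module.Dual ℂ W →ₗ[ℂ] P.SPlus} (hF : IsPureMap F) : Function.Injective F := by
  rw [injective_iff_map_eq_zero]
  intro f hf
  by_contra h
  have := (isPure_iff.1 (hF f h)).ne_zero hQ
  rw [hf] at this
  exact this rfl

theorem coe_spinorRep_apply (g : Symm Q q) (ψ : P.SPlus) :
    (spinorRep P q g ψ : P.Spinor)
      = P.cliffordAction ((g.2.2 : ℂ) • (g.1 : CliffordAlgebra Q)) ψ := by
  rw [map_smul]
  rfl

theorem isPure_spinorRep (g : Symm Q q) {ψ : P.SPlus} (h : P.IsPure ψ) :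
    P.IsPure (spinorRep P q g ψ) := by
  rw [isPure_iff, coe_spinorRep_apply]
  exact (isPure_iff.1 h).map ⟨_, ⟨g.2.2, g.1, rfl⟩, rfl⟩

theorem two_le_finrank_L [FiniteDimensional ℂ V] (hQ : Q.polarBilin.Nondegenerate)
    (hV : Module.finrank ℂ V = 10) : 2 ≤ Module.finrank ℂ P.L := by
  have h1 := LinearMap.finrank_range_add_finrank_ker P.covector
  have h2 : LinearMap.ker P.covector = P.L := by
    ext v
    exact covector_eq_zero_iff hQ
  have h3 := Submodule.finrank_le (LinearMap.range P.covector)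
  rw [Subspace.dual_finrank_eq] at h3
  rw [h2, hV] at h1
  omega

theorem exists_wedge_wedge_ne_zero [FiniteDimensional ℂ V] (h : 2 ≤ Module.finrank ℂ P.L) :
    ∃ α β : Module.Dual ℂ P.L, P.wedge α (P.wedge β 1) ≠ 0 := by
  let b := Module.finBasis ℂ P.L
  refine ⟨b.coord ⟨0, by omega⟩, b.coord ⟨1, by omega⟩,
    wedge_wedge_one_ne_zero (l := b ⟨1, by omega⟩) (m := b ⟨0, by omega⟩) ?_ ?_ ?_⟩ <;> simp

theorem one_mem_evenPart : (1 : P.Spinor) ∈ P.evenPart := by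
  rw [evenPart_eq]
  exact CliffordAlgebra.one_le_evenOdd_zero _ (Submodule.mem_one.2 ⟨1, map_one _⟩)

theorem wedge_wedge_one_mem_evenPart (α β : Module.Dual ℂ P.L) :
    P.wedge α (P.wedge β 1) ∈ P.evenPart := by
  rw [evenPart_eq, wedge_apply, wedge_apply, mul_one]
  exact CliffordAlgebra.ι_mul_ι_mem_evenOdd_zero _ _ _

/-- A basis of the two-dimensional space of functionals on `W`. -/
theorem nonempty_basis_dual [FiniteDimensional ℂ W] (hW : Module.finrank ℂ W = 2) :
    Nonempty (Module.Basis (Fin 2) ℂ (Module.Dual ℂ W)) :=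
  ⟨Module.finBasisOfFinrankEq ℂ _ (by rw [Subspace.dual_finrank_eq, hW])⟩

variable (P W) in
theorem exists_isPureMap [FiniteDimensional ℂ V] [FiniteDimensional ℂ W]
    (hQ : Q.polarBilin.Nondegenerate) (hV : Module.finrank ℂ V = 10)
    (hW : Module.finrank ℂ W = 2) : ∃ F : Module.Dual ℂ W →ₗ[ℂ] P.SPlus, IsPureMap F := by
  obtain ⟨b⟩ := nonempty_basis_dual hW
  obtain ⟨α, β, hαβ⟩ := exists_wedge_wedge_ne_zero (two_le_finrank_L (P := P) hQ hV)
  refine ⟨b.constr ℂ ![⟨1, one_mem_evenPart⟩, ⟨_, wedge_wedge_one_mem_evenPart α β⟩],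
    fun f hf => ?_⟩
  have hab : b.repr f 0 ≠ 0 ∨ b.repr f 1 ≠ 0 := by
    by_contra! hc
    apply hf
    rw [← b.sum_repr f, Fin.sum_univ_two, hc.1, hc.2, zero_smul, zero_smul, add_zero]
  have := isPureSpinor_smul_one_add_smul_wedge hQ hαβ hab
  rw [isPure_iff, Module.Basis.constr_apply_fintype ℂ b, Fin.sum_univ_two]
  simpa using this

/-- The group `G` acts transitively on the linear families of pure spinors, already through
`Spin(V) × ℂˣ`. -/
theorem IsPureMap.exists_spinorRep_eq [FiniteDimensional ℂ V] [FiniteDimensional ℂ W]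
    (hQ : Q.polarBilin.Nondegenerate) (hV : Module.finrank ℂ V = 10)
    (hW : Module.finrank ℂ W = 2) {F F' : Module.Dual ℂ W →ₗ[ℂ] P.SPlus} (hF : IsPureMap F)
    (hF' : IsPureMap F') :
    ∃ g : Symm Q q, g.2.1 = 1 ∧ ∀ f, spinorRep P q g (F f) = F' f := by
  have : Nontrivial V := Module.nontrivial_of_finrank_pos (R := ℂ) (by omega)
  obtain ⟨b⟩ := nonempty_basis_dual hW
  obtain ⟨α, β, hαβ⟩ := exists_wedge_wedge_ne_zero (two_le_finrank_L (P := P) hQ hV)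
  have key : ∀ {F : Module.Dual ℂ W →ₗ[ℂ] P.SPlus}, IsPureMap F → ∃ k ∈ P.spinOperators,
      k (F (b 0)) = 1 ∧ k (F (b 1)) = P.wedge α (P.wedge β 1) := by
    intro F hF
    refine exists_spinOperators_pair hQ (F (b 0)).2 (fun c d hcd => ?_) hαβ
    have hne : c • b 0 + d • b 1 ≠ 0 := by
      intro h0
      have h1 := Fintype.linearIndependent_iff.1 b.linearIndependent ![c, d]
        (by simpa [Fin.sum_univ_two] using h0)
      exact hcd.elim (fun h => h (h1 0)) fun h => h (h1 1)
    simpa using isPure_iff.1 (hF _ hne)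
  obtain ⟨k, hk, h0, h1⟩ := key hF
  obtain ⟨k', hk', h0', h1'⟩ := key hF'
  obtain ⟨k'', hk'', hkk, -⟩ := exists_spinOperators_mul_eq_one hk'
  have hinv : ∀ ψ, k'' (k' ψ) = ψ := fun ψ => LinearMap.congr_fun hkk ψ
  obtain ⟨_, ⟨t, g, rfl⟩, hg⟩ := mul_mem hk'' hk
  refine ⟨(g, 1, t), rfl, fun f => ?_⟩
  have hF : spinorRep P q (g, 1, t) ∘ₗ F = F' := by
    refine b.ext fun i => Subtype.ext ?_
    rw [LinearMap.comp_apply, coe_spinorRep_apply]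
    have : P.cliffordAction ((t : ℂ) • (g : CliffordAlgebra Q)) = k'' * k := hg
    rw [this, Module.End.mul_apply]
    fin_cases i
    · change k'' (k (F (b 0))) = F' (b 0)
      rw [h0, ← h0', hinv]
    · change k'' (k (F (b 1))) = F' (b 1)
      rw [h1, ← h1', hinv]
  exact LinearMap.congr_fun hF f

/-- The condition `𝒫 ∩ ℙ(U) = ℙ(U)` says that every nonzero element of `U` is pure. -/
theorem pureVariety_inter_projSpan_eq_iff (U : Submodule ℂ P.SPlus) :
    P.pureVariety ∩ P.projSpan U = P.projSpan U ↔ ∀ ψ ∈ U, ψ ≠ 0 → P.IsPure ψ := by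
  rw [Set.inter_eq_right]
  constructor
  · intro h ψ hψ h0
    obtain ⟨φ, hφ, hpure, heq⟩ := h (show Projectivization.mk ℂ ψ h0 ∈ P.projSpan U by
      rwa [projSpan, Set.mem_ofPred_eq, Projectivization.submodule_mk,
        Submodule.span_singleton_le_iff_mem])
    obtain ⟨a, ha⟩ := (Projectivization.mk_eq_mk_iff ℂ _ _ _ _).1 heq
    rw [isPure_iff, ← ha, Units.smul_def]
    have := (isPure_iff.1 hpure).map (smul_one_mem_spinOperators a.ne_zero)
    simpa using this
  · intro h p
    induction p using Projectivization.ind with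
    | h ψ h0 =>
      intro hp
      rw [projSpan, Set.mem_ofPred_eq, Projectivization.submodule_mk,
        Submodule.span_singleton_le_iff_mem] at hp
      exact ⟨ψ, h0, h ψ hp h0, rfl⟩

end PureMap

/-! ### Framed subspaces and supercharges -/

section Orbits

open Polarization

variable {V : Type*} [AddCommGroup V] [Module ℂ V] {Q : QuadraticForm ℂ V} {P : Polarization Q}
variable {W : Type*} [AddCommGroup W] [Module ℂ W] {q : QuadraticForm ℂ W}

/-- The linear map from the dual of `W` to `S_+` underlying a pair `(U, φ)`. -/
def FramedSubspace.toMap (x : FramedSubspace P W) : Module.Dual ℂ W →ₗ[ℂ] P.SPlus :=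
  x.U.subtype ∘ₗ x.φ.toLinearMap

theorem FramedSubspace.range_toMap (x : FramedSubspace P W) : LinearMap.range x.toMap = x.U := by
  rw [toMap, LinearMap.range_comp, LinearEquiv.range, Submodule.map_top, Submodule.range_subtype]

theorem FramedSubspace.toMap_injective :
    Function.Injective (toMap : FramedSubspace P W → Module.Dual ℂ W →ₗ[ℂ] P.SPlus) := by
  intro x y h
  refine FramedSubspace.ext' P ?_ fun f => LinearMap.congr_fun h f
  rw [← x.range_toMap, ← y.range_toMap, h]

theorem FramedSubspace.toMap_smul (g : Symm Q q) (x : FramedSubspace P W)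
    (f : Module.Dual ℂ W) :
    (g • x).toMap f = spinorRep P q g (x.toMap (f ∘ₗ ((g.2.1 : W ≃ₗ[ℂ] W) : W →ₗ[ℂ] W))) := rfl

theorem Supercharge.toMap_smul (g : Symm Q q) (x : Supercharge P W) (f : Module.Dual ℂ W) :
    Supercharge.toMap P (g • x) f
      = spinorRep P q g (x.toMap P (f ∘ₗ ((g.2.1 : W ≃ₗ[ℂ] W) : W →ₗ[ℂ] W))) := by
  change Supercharge.toMap P (TensorProduct.map (spinorRep P q g)
    ((g.2.1 : W ≃ₗ[ℂ] W) : W →ₗ[ℂ] W) x) f = _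
  induction x using TensorProduct.induction_on with
  | zero => simp [Supercharge.toMap]
  | tmul ψ w => simp [Supercharge.toMap]
  | add x y hx hy =>
    simp only [Supercharge.toMap, LinearMap.coe_mk, AddHom.coe_mk, map_add] at hx hy ⊢
    rw [hx, hy]

theorem Supercharge.toMap_bijective [FiniteDimensional ℂ W] :
    Function.Bijective
      (Supercharge.toMap P : Supercharge P W → Module.Dual ℂ W →ₗ[ℂ] P.SPlus) := by
  let e : Supercharge P W ≃ₗ[ℂ] (Module.Dual ℂ W →ₗ[ℂ] P.SPlus) :=
    (TensorProduct.comm ℂ P.SPlus W ≪≫ₗ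
      TensorProduct.congr (Module.evalEquiv ℂ W) (LinearEquiv.refl ℂ P.SPlus)) ≪≫ₗ
      dualTensorHomEquiv ℂ (Module.Dual ℂ W) P.SPlus
  have he : (Supercharge.toMap P : Supercharge P W → Module.Dual ℂ W →ₗ[ℂ] P.SPlus) = e := by
    ext x f : 2
    induction x using TensorProduct.induction_on with
    | zero => simp [Supercharge.toMap]
    | tmul ψ w => simp [Supercharge.toMap, e]
    | add x y hx hy =>
      rw [map_add, LinearMap.add_apply, ← hx, ← hy]
      simp [Supercharge.toMap]
  rw [he]
  exact e.bijective

/-- Two elements of a `G`-set that embeds equivariantly in the linear families of spinors are in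
the same orbit when their families are pure. -/
theorem orbit_eq_of_toMap [FiniteDimensional ℂ V] [FiniteDimensional ℂ W]
    (hQ : Q.polarBilin.Nondegenerate) (hV : Module.finrank ℂ V = 10)
    (hW : Module.finrank ℂ W = 2) {X : Type*} [MulAction (Symm Q q) X]
    (T : X → Module.Dual ℂ W →ₗ[ℂ] P.SPlus) (hT : Function.Injective T)
    (hsmul : ∀ (g : Symm Q q) (x : X) (f : Module.Dual ℂ W),
      T (g • x) f = spinorRep P q g (T x (f ∘ₗ ((g.2.1 : W ≃ₗ[ℂ] W) : W →ₗ[ℂ] W))))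
    {x : X} (hx : IsPureMap (T x)) :
    MulAction.orbit (Symm Q q) x = {y | IsPureMap (T y)} := by
  ext y
  constructor
  · rintro ⟨g, rfl⟩ f hf
    change P.IsPure (T (g • x) f)
    rw [hsmul]
    refine isPure_spinorRep g (hx _ fun h0 => hf (LinearMap.ext fun w => ?_))
    simpa using LinearMap.congr_fun h0 ((g.2.1 : W ≃ₗ[ℂ] W).symm w)
  · intro hy
    obtain ⟨g, hg, h⟩ := hx.exists_spinorRep_eq (q := q) hQ hV hW hy
    refine ⟨g, hT (LinearMap.ext fun f => ?_)⟩
    change T (g • x) f = _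
    rw [hsmul, hg]
    exact h f

theorem mem_purePairs_iff [FiniteDimensional ℂ W] (hW : Module.finrank ℂ W = 2)
    (x : FramedSubspace P W) : x ∈ purePairs P W ↔ IsPureMap x.toMap := by
  rw [purePairs, Set.mem_ofPred_eq, pureVariety_inter_projSpan_eq_iff]
  constructor
  · rintro ⟨-, h⟩ f hf
    exact h _ (x.φ f).2 fun h0 => hf (x.φ.map_eq_zero_iff.1 (Subtype.ext h0))
  · intro h
    refine ⟨by rw [← x.φ.finrank_eq, Subspace.dual_finrank_eq, hW], fun ψ hψ h0 => ?_⟩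
    obtain ⟨f, hf⟩ := x.φ.surjective ⟨ψ, hψ⟩
    have hfψ : x.toMap f = ψ := congrArg Subtype.val hf
    rw [← hfψ]
    refine h f ?_
    rintro rfl
    exact h0 (by rw [← hfψ, map_zero])

theorem mem_pureSupercharges_iff [Nontrivial V] [FiniteDimensional ℂ W]
    (hQ : Q.polarBilin.Nondegenerate) (hW : Module.finrank ℂ W = 2) (x : Supercharge P W) :
    x ∈ pureSupercharges P W ↔ IsPureMap (x.toMap P) := by
  have hW' : Module.finrank ℂ (Module.Dual ℂ W) = 2 := by rw [Subspace.dual_finrank_eq, hW]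
  rw [pureSupercharges, Set.mem_ofPred_eq, pureVariety_inter_projSpan_eq_iff]
  constructor
  · rintro ⟨hr, h⟩ f hf
    refine h _ ⟨f, rfl⟩ fun h0 => hf ?_
    have hker : LinearMap.ker (x.toMap P) = ⊥ := by
      have := LinearMap.finrank_range_add_finrank_ker (x.toMap P)
      rw [← Submodule.finrank_eq_zero (R := ℂ)]
      omega
    exact LinearMap.ker_eq_bot'.1 hker f h0
  · intro h
    refine ⟨by rw [LinearMap.finrank_range_of_inj (h.injective hQ), hW'], ?_⟩
    rintro _ ⟨f, rfl⟩ h0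
    refine h f ?_
    rintro rfl
    exact h0 (map_zero _)

end Orbits

end IIB

theorem mainTheorem3 {V : Type*} [AddCommGroup V] [Module ℂ V]
    (Q : QuadraticForm ℂ V) (hQ : Q.polarBilin.Nondegenerate) (hV : Module.finrank ℂ V = 10)
    (P : IIB.Polarization Q)
    {W : Type*} [AddCommGroup W] [Module ℂ W]
    (q : QuadraticForm ℂ W) (hq : q.polarBilin.Nondegenerate) (hW : Module.finrank ℂ W = 2) :
    ((IIB.purePairs P W).Nonempty ∧
      ∀ x ∈ IIB.purePairs P W, MulAction.orbit (IIB.Symm Q q) x = IIB.purePairs P W) ∧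
    ((IIB.pureSupercharges P W).Nonempty ∧
      ∀ x ∈ IIB.pureSupercharges P W,
        MulAction.orbit (IIB.Symm Q q) x = IIB.pureSupercharges P W) := by
  have : FiniteDimensional ℂ V := Module.finite_of_finrank_pos (by omega)
  have : FiniteDimensional ℂ W := Module.finite_of_finrank_pos (by omega)
  have : Nontrivial V := Module.nontrivial_of_finrank_pos (R := ℂ) (by omega)
  obtain ⟨F, hF⟩ := IIB.exists_isPureMap P W hQ hV hW
  have hpairs : IIB.purePairs P W = {x | IIB.IsPureMap x.toMap} :=
    Set.ext (IIB.mem_purePairs_iff hW)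
  have hcharges : IIB.pureSupercharges P W = {x | IIB.IsPureMap (x.toMap P)} :=
    Set.ext (IIB.mem_pureSupercharges_iff hQ hW)
  rw [hpairs, hcharges]
  refine ⟨⟨⟨⟨_, LinearEquiv.ofInjective F (hF.injective hQ)⟩, hF⟩,
    fun x hx => ?_⟩, ?_, fun x hx => ?_⟩
  · exact IIB.orbit_eq_of_toMap hQ hV hW _ IIB.FramedSubspace.toMap_injective
      IIB.FramedSubspace.toMap_smul hx
  · obtain ⟨x, rfl⟩ := IIB.Supercharge.toMap_bijective.2 F
    exact ⟨x, hF⟩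
  · exact IIB.orbit_eq_of_toMap hQ hV hW _ IIB.Supercharge.toMap_bijective.1
      IIB.Supercharge.toMap_smul hx
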